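/- Let $d\ge 1$ and let $h:\mathbb{R}^d\to\{\text{subsets of }\mathbb{R}^d\}$. On a probability space consider random vectors in $\mathbb{R}^d$ with $$x_{n+1}=x_n+a(n)\,[\,y_n+M_{n+1}\,],\qquad y_n\in h(x_n),\qquad n\ge 0 .$$ Definitions. A solution of $\dot x\in H(x)$ is a locally absolutely continuous map $\mathbf{x}:[0,\infty)\to\mathbb{R}^d$ with $\dot{\mathbf{x}}(t)\in H(\mathbf{x}(t))$ for almost every $t$. A compact set $A$ is an attracting set with fundamental neighborhood $U$ if $U$ is a neighborhood of $A$ and for every $\epsilon>0$ there is $T(\epsilon)\ge 0$ such that $\mathbf{x}(t)\in N^{\epsilon}(A)=\{z: d(z,A)<\epsilon\}$ for every solution $\mathbf{x}$ with $\mathbf{x}(0)\in U$ and every $t\ge T(\epsilon)$. A set $S$ is invariant if for every $x\in S$ there is a solution $\mathbf{x}$ with $\mathbf{x}(0)=x$ and $\mathbf{x}(t)\in S$ for all $t\ge 0$. A set $S$ is internally chain transitive if it is compact and for all $x,y\in S$, $\epsilon>0$, $T>0$ there are $n\ge 1$, points $x_1=x,\dots,x_{n+1}=y$ in $S$, solutions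 $\Phi^1,\dots,\Phi^n$ and reals $t_1,\dots,t_n>T$ such that, for $1\le i\le n$, $\Phi^i(0)=x_i$, $\Phi^i([0,t_i])\subset S$ and $\|\Phi^i(t_i)-x_{i+1}\|<\epsilon$. For real $c\ge 1$ put $h_c(x)=\{y: cy\in h(cx)\}$, and let $$h_\infty(x)=\overline{\{y:\ \lim_{c\to\infty} d(y,h_c(x))=0\}},\qquad d(y,\emptyset)=\infty .$$ Assume: (A1) $h$ is a Marchaud map: every $h(x)$ is convex and compact, there is $K>0$ with $\|w\|<K(1+\|x\|)$ for all $x$ and all $w\in h(x)$, and the graph of $h$ is closed. (A2) $a(n)>0$ for all $n$, $\sum_n a(n)=\infty$ and $\sum_n a(n)^2<\infty$. (A3) $\{M_n\}_{n\ge1}$ is a square-integrable martingale difference sequence with respect to $\mathcal{F}_n=\sigma(x_0,M_1,\dots,M_n)$, and for some $K>0$, almost surely $E[\|M_{n+1}\|^2\mid\mathcal{F}_n]\le K(1+\|x_n\|^2)$ for all $n\ge 0$. (A4) $h_\infty(x)\ne\emptyset$ for all $x$, and $\dot x\in h_\infty(x)$ has an attracting set $\mathcal{A}\subseteq B_1(0)$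 (the open unit ball) with a fundamental neighborhood that contains the closed unit ball $\overline{B}_1(0)$. (A5) If $c_n\ge1$ are integers with $c_n\uparrow\infty$, $x_n\to x$, $y_n\to y$ and $y_n\in h_{c_n}(x_n)$ for all $n$, then $y\in h_\infty(x)$. Then, almost surely, the sequence $\{x_n\}_{n\ge0}$ is bounded and there is a (sample path dependent) nonempty closed, connected, internally chain transitive and invariant set $S$ of $\dot x\in h(x)$ such that $d(x_n,S)\to0$ as $n\to\infty$. -/

import Mathlib

open MeasureTheory Filter Topology

namespace SRI

/-- The state space `ℝ^d` with its Euclidean norm. -/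
abbrev State (d : ℕ) : Type := EuclideanSpace ℝ (Fin d)

/-- A Marchaud map: convex compact values, linear growth and closed graph. -/
structure IsMarchaud {d : ℕ} (h : State d → Set (State d)) : Prop where
  convex : ∀ x, Convex ℝ (h x)
  compact : ∀ x, IsCompact (h x)
  growth : ∃ K : ℝ, 0 < K ∧ ∀ x, ∀ w ∈ h x, ‖w‖ < K * (1 + ‖x‖)
  closed_graph : IsClosed {p : State d × State d | p.2 ∈ h p.1}

/-- `x`, restricted to `[0, ∞)`, is a (locally) absolutely continuous solution of `ẋ ∈ H(x)`. -/
structure IsSolution {d : ℕ} (H : State d → Set (State d)) (x : ℝ → State d) : Prop where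
  absCont : ∀ T : ℝ, 0 ≤ T → AbsolutelyContinuousOnInterval x 0 T
  inclusion : ∀ᵐ t ∂(volume.restrict (Set.Ioi (0 : ℝ))), ∃ v ∈ H (x t), HasDerivAt x v t

/-- The set-valued semiflow `Φ_t(x)` of `ẋ ∈ H(x)`. -/
def flow {d : ℕ} (H : State d → Set (State d)) (t : ℝ) (x : State d) : Set (State d) :=
  {z | ∃ φ : ℝ → State d, IsSolution H φ ∧ φ 0 = x ∧ φ t = z}

/-- `Φ_B(M)`, the union of `Φ_t(x)` over `t ∈ B` and `x ∈ M`. -/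
def flowImage {d : ℕ} (H : State d → Set (State d)) (B : Set ℝ) (M : Set (State d)) :
    Set (State d) :=
  ⋃ t ∈ B, ⋃ x ∈ M, flow H t x

/-- `A` is an attracting set of `ẋ ∈ H(x)` with fundamental neighborhood `U`. -/
structure IsAttractingSet {d : ℕ} (H : State d → Set (State d)) (A U : Set (State d)) :
    Prop where
  compact : IsCompact A
  nhds : U ∈ 𝓝ˢ A
  attracts : ∀ ε : ℝ, 0 < ε → ∃ T : ℝ, 0 ≤ T ∧
    flowImage H (Set.Ici T) U ⊆ Metric.thickening ε A

/-- Invariance: through every point of `M` there is a solution on `[0, ∞)` staying in `M`. -/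
def IsInvariant {d : ℕ} (H : State d → Set (State d)) (M : Set (State d)) : Prop :=
  ∀ x ∈ M, ∃ φ : ℝ → State d, IsSolution H φ ∧ φ 0 = x ∧ ∀ t : ℝ, 0 ≤ t → φ t ∈ M

/-- An `(ε, T)` chain in `M` from `x` to `y`; it has `n + 1 ≥ 1` pieces. The points of the chain
are `p 0 = x, …, p (n + 1) = y`. -/
def HasChain {d : ℕ} (H : State d → Set (State d)) (M : Set (State d)) (ε T : ℝ)
    (x y : State d) : Prop :=
  ∃ (n : ℕ) (p : Fin (n + 2) → State d) (φ : Fin (n + 1) → ℝ → State d) (t : Fin (n + 1) → ℝ),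
    p 0 = x ∧ p (Fin.last (n + 1)) = y ∧ (∀ i, p i ∈ M) ∧
    ∀ i : Fin (n + 1), IsSolution H (φ i) ∧ φ i 0 = p i.castSucc ∧ T < t i ∧
      (∀ s ∈ Set.Icc 0 (t i), φ i s ∈ M) ∧ dist (φ i (t i)) (p i.succ) < ε

/-- Internally chain transitive sets of `ẋ ∈ H(x)`. -/
def IsInternallyChainTransitive {d : ℕ} (H : State d → Set (State d)) (M : Set (State d)) :
    Prop :=
  IsCompact M ∧ ∀ x ∈ M, ∀ y ∈ M, ∀ ε : ℝ, 0 < ε → ∀ T : ℝ, 0 < T → HasChain H M ε T x y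

/-- The rescaled map `h_c(x) = {y | c y ∈ h(c x)}`. -/
def rescale {d : ℕ} (h : State d → Set (State d)) (c : ℝ) (x : State d) : Set (State d) :=
  {y | c • y ∈ h (c • x)}

/-- The lower limit, as the real parameter `c` tends to infinity, of a family of sets. The distance
to the empty set is `∞`. -/
def lowerLimit {d : ℕ} (K : ℝ → Set (State d)) : Set (State d) :=
  {y | Tendsto (fun c : ℝ => Metric.infEDist y (K c)) atTop (𝓝 0)}

/-- `h_∞(x)`, the closure of the lower limit of `h_c(x)` as `c → ∞`. -/
def hInf {d : ℕ} (h : State d → Set (State d)) (x : State d) : Set (State d) :=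
  closure (lowerLimit fun c => rescale h c x)

/-- The σ-algebra `σ(x₀, M₁, …, M_n)`. -/
@[reducible] def noiseSigma {Ω : Type*} {d : ℕ} (x₀ : Ω → State d) (M : ℕ → Ω → State d) (n : ℕ) :
    MeasurableSpace Ω :=
  MeasurableSpace.comap x₀ inferInstance ⊔
    ⨆ k ∈ Finset.Icc 1 n, MeasurableSpace.comap (M k) inferInstance

/-- The step sizes are positive, with divergent sum and convergent sum of squares. -/
structure StepSizes (a : ℕ → ℝ) : Prop where
  pos : ∀ n, 0 < a n
  sum_diverges : Tendsto (fun n => ∑ i ∈ Finset.range n, a i) atTop atTop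
  sq_summable : Summable fun n => a n ^ 2

/-- `M₁, M₂, …` is a square integrable martingale difference sequence for `σ(x₀, M₁, …, M_n)`
whose conditional second moments are bounded by `K (1 + ‖x_n‖²)`. (`M 0` plays no role.) -/
structure MartingaleNoise {Ω : Type*} [MeasurableSpace Ω] {d : ℕ} (μ : Measure Ω)
    (x M : ℕ → Ω → State d) : Prop where
  measurable_init : Measurable (x 0)
  measurable_noise : ∀ n, Measurable (M (n + 1))
  sq_integrable : ∀ n, MemLp (M (n + 1)) 2 μ
  mds : ∀ n, μ[M (n + 1) | noiseSigma (x 0) M n] =ᵐ[μ] 0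
  cond_sq_le : ∃ K : ℝ, 0 < K ∧ ∀ n,
    μ[fun ω => ‖M (n + 1) ω‖ ^ 2 | noiseSigma (x 0) M n]
      ≤ᵐ[μ] fun ω => K * (1 + ‖x n ω‖ ^ 2)

/-- `h_∞` has nonempty values, and `ẋ ∈ h_∞(x)` has an attracting set inside the open unit ball
with a fundamental neighborhood that contains the closed unit ball. -/
structure InfinityAttracting {d : ℕ} (h : State d → Set (State d)) : Prop where
  nonempty : ∀ x, (hInf h x).Nonempty
  attracting : ∃ A U : Set (State d), IsAttractingSet (hInf h) A U ∧
    Metric.closedBall 0 1 ⊆ U ∧ A ⊆ Metric.ball 0 1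

/-- Limits of `y_n ∈ h_{c_n}(x_n)` along integers `c_n ↑ ∞` lie in `h_∞`. -/
def InfinityClosed {d : ℕ} (h : State d → Set (State d)) : Prop :=
  ∀ (c : ℕ → ℕ) (u v : ℕ → State d) (x y : State d),
    StrictMono c → (∀ n, 1 ≤ c n) → Tendsto u atTop (𝓝 x) → Tendsto v atTop (𝓝 y) →
    (∀ n, v n ∈ rescale h (c n : ℝ) (u n)) → y ∈ hInf h x

end SRI

/-
Switch the noise `M (n + 1)` off wherever its conditional second moment exceeds `4 ^ j`. The maximal
inequality then controls the weighted sums at scale `2 ^ j`, for all `j` at once because the errors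
can be summed over the dyadic scales, and hence over clock windows of bounded length the noise is
eventually negligible against the path, at whatever scale the path lives. Windows of the path that
start later and later, rescaled to bounded size, are then asymptotically Lipschitz with averaged
increments in convex combinations of drifts, so along an ultrafilter they converge locally uniformly
to a solution of the limiting inclusion.

If the starting norms tend to infinity and the windows are scaled by them, the limits solve
`ẋ ∈ h_∞(x)` and start on the unit sphere, from where the attracting set pulls them into the open
ball within a fixed time `T`. So the path does not gain norm over time `T` when it is far out, and
it is bounded. Without rescaling the limits solve `ẋ ∈ h(x)` and run inside the limit set of the
path, which is therefore invariant; late pieces of the path are shadowed by such solutions, and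
replacing consecutive pieces by their shadows gives the chains.
-/

namespace SRI

section MartingaleDifferences

variable {Ω E : Type*} {mΩ : MeasurableSpace Ω} {μ : Measure Ω} {F : Filtration ℕ mΩ}

/-- The filtration that starts at time `m`. -/
def shiftFiltration (F : Filtration ℕ mΩ) (m : ℕ) : Filtration ℕ mΩ where
  seq k := F (m + k)
  mono' _ _ hij := F.mono (Nat.add_le_add_left hij m)
  le' k := F.le (m + k)

section NormedSpace

variable [NormedAddCommGroup E] [NormedSpace ℝ E] {D : ℕ → Ω → E}

/-- Square integrable martingale differences. They are indexed so that `D k` is revealed at time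
`k + 1` and is centred given `F k`. -/
structure IsSqIntegrableMDS (F : Filtration ℕ mΩ) (μ : Measure Ω) (D : ℕ → Ω → E) : Prop where
  stronglyMeasurable : ∀ k, StronglyMeasurable[F (k + 1)] (D k)
  memLp : ∀ k, MemLp (D k) 2 μ
  condExp_eq_zero : ∀ k, μ[D k | F k] =ᵐ[μ] 0

namespace IsSqIntegrableMDS

lemma shift (hD : IsSqIntegrableMDS F μ D) (m : ℕ) :
    IsSqIntegrableMDS (shiftFiltration F m) μ (fun k => D (m + k)) where
  stronglyMeasurable k := hD.stronglyMeasurable (m + k)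
  memLp k := hD.memLp (m + k)
  condExp_eq_zero k := hD.condExp_eq_zero (m + k)

lemma stronglyMeasurable_sum (hD : IsSqIntegrableMDS F μ D) (n : ℕ) :
    StronglyMeasurable[F n] (fun ω => ∑ k ∈ Finset.range n, D k ω) :=
  Finset.stronglyMeasurable_fun_sum _ fun k hk =>
    (hD.stronglyMeasurable k).mono (F.mono (Finset.mem_range.1 hk))

lemma memLp_sum (hD : IsSqIntegrableMDS F μ D) (n : ℕ) :
    MemLp (fun ω => ∑ k ∈ Finset.range n, D k ω) 2 μ :=
  memLp_finsetSum _ fun k _ => hD.memLp k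

lemma integrable_norm_sq_sum (hD : IsSqIntegrableMDS F μ D) (n : ℕ) :
    Integrable (fun ω => ‖∑ k ∈ Finset.range n, D k ω‖ ^ 2) μ :=
  (hD.memLp_sum n).integrable_norm_pow two_ne_zero

lemma integrable_norm_sq (hD : IsSqIntegrableMDS F μ D) (n : ℕ) :
    Integrable (fun ω => ‖D n ω‖ ^ 2) μ :=
  (hD.memLp n).integrable_norm_pow two_ne_zero

lemma const_smul_indicator [CompleteSpace E] [IsFiniteMeasure μ] (hD : IsSqIntegrableMDS F μ D)
    (b : ℕ → ℝ) {s : ℕ → Set Ω} (hs : ∀ k, MeasurableSet[F k] (s k)) :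
    IsSqIntegrableMDS F μ (fun k => b k • (s k).indicator (D k)) where
  stronglyMeasurable k :=
    ((hD.stronglyMeasurable k).indicator (F.mono k.le_succ _ (hs k))).const_smul (b k)
  memLp k := ((hD.memLp k).indicator (F.le k _ (hs k))).const_smul (b k)
  condExp_eq_zero k := by
    filter_upwards [condExp_smul (μ := μ) (b k) ((s k).indicator (D k)) (F k),
      condExp_indicator ((hD.memLp k).integrable one_le_two) (hs k), hD.condExp_eq_zero k]
      with ω hsmul hindicator hzero
    classical
    rw [hsmul, Pi.smul_apply, hindicator, Set.indicator_apply, hzero]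
    simp

end IsSqIntegrableMDS

end NormedSpace

section InnerProductSpace

variable [NormedAddCommGroup E] [InnerProductSpace ℝ E] {D : ℕ → Ω → E}

lemma norm_sq_sum_range_succ (v : ℕ → E) (n : ℕ) :
    ‖∑ k ∈ Finset.range (n + 1), v k‖ ^ 2 = ‖∑ k ∈ Finset.range n, v k‖ ^ 2
      + (2 * inner ℝ (∑ k ∈ Finset.range n, v k) (v n) + ‖v n‖ ^ 2) := by
  rw [Finset.sum_range_succ, norm_add_sq_real, add_assoc]

namespace IsSqIntegrableMDS

lemma integrable_inner (hD : IsSqIntegrableMDS F μ D) (n : ℕ) :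
    Integrable (fun ω => inner ℝ (∑ k ∈ Finset.range n, D k ω) (D n ω)) μ :=
  ((hD.memLp_sum n).norm.integrable_mul (hD.memLp n).norm).mono'
    ((hD.memLp_sum n).aestronglyMeasurable.inner (hD.memLp n).aestronglyMeasurable)
    (ae_of_all _ fun _ => norm_inner_le_norm _ _)

variable [IsFiniteMeasure μ] [CompleteSpace E]

lemma condExp_inner (hD : IsSqIntegrableMDS F μ D) (n : ℕ) :
    μ[fun ω => inner ℝ (∑ k ∈ Finset.range n, D k ω) (D n ω) | F n] =ᵐ[μ] 0 := by
  have hpull := condExp_bilin_of_stronglyMeasurable_left (m := F n) (μ := μ) (innerSL ℝ (E := E))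
    (hD.stronglyMeasurable_sum n) (g := D n) (hD.integrable_inner n)
    ((hD.memLp n).integrable one_le_two)
  filter_upwards [hpull, hD.condExp_eq_zero n] with ω hpull hzero
  rw [Pi.zero_apply] at hzero ⊢
  exact hpull.trans (by rw [hzero, map_zero])

lemma integral_norm_sq_sum (hD : IsSqIntegrableMDS F μ D) (n : ℕ) :
    ∫ ω, ‖∑ k ∈ Finset.range n, D k ω‖ ^ 2 ∂μ = ∑ k ∈ Finset.range n, ∫ ω, ‖D k ω‖ ^ 2 ∂μ := by
  induction n with
  | zero => simp
  | succ n ih =>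
    have hcross : ∫ ω, inner ℝ (∑ k ∈ Finset.range n, D k ω) (D n ω) ∂μ = 0 := by
      rw [← integral_condExp (F.le n), integral_congr_ae (hD.condExp_inner n)]
      simp
    have hcross_int := (hD.integrable_inner n).const_mul 2
    have hincr_int : Integrable (fun ω => 2 * inner ℝ (∑ k ∈ Finset.range n, D k ω) (D n ω)
        + ‖D n ω‖ ^ 2) μ := hcross_int.add (hD.integrable_norm_sq n)
    simp_rw [norm_sq_sum_range_succ]
    rw [integral_add (hD.integrable_norm_sq_sum n) hincr_int,
      integral_add hcross_int (hD.integrable_norm_sq n), integral_const_mul, hcross, ih,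
      Finset.sum_range_succ, mul_zero, zero_add]

lemma submartingale_norm_sq_sum (hD : IsSqIntegrableMDS F μ D) :
    Submartingale (fun n ω => ‖∑ k ∈ Finset.range n, D k ω‖ ^ 2) F μ := by
  refine submartingale_of_condExp_sub_nonneg_nat
    (fun n => (hD.stronglyMeasurable_sum n).norm.pow 2) hD.integrable_norm_sq_sum fun n => ?_
  have hincrement : (fun ω => ‖∑ k ∈ Finset.range (n + 1), D k ω‖ ^ 2)
      - (fun ω => ‖∑ k ∈ Finset.range n, D k ω‖ ^ 2)
      = (2 : ℝ) • (fun ω => inner ℝ (∑ k ∈ Finset.range n, D k ω) (D n ω))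
        + fun ω => ‖D n ω‖ ^ 2 :=
    funext fun ω => sub_eq_iff_eq_add'.2 (norm_sq_sum_range_succ (fun k => D k ω) n)
  have hnonneg : 0 ≤ᵐ[μ] μ[fun ω => ‖D n ω‖ ^ 2 | F n] :=
    condExp_nonneg (ae_of_all _ fun _ => sq_nonneg _)
  rw [hincrement]
  filter_upwards [
    condExp_add ((hD.integrable_inner n).smul (2 : ℝ)) (hD.integrable_norm_sq n) (F n),
    condExp_smul (2 : ℝ) (fun ω => inner ℝ (∑ k ∈ Finset.range n, D k ω) (D n ω)) (F n),
    hnonneg, hD.condExp_inner n] with ω hadd hsmul hnonneg hzero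
  rw [hadd, Pi.add_apply, hsmul, Pi.smul_apply, hzero]
  simpa using hnonneg

lemma measure_exists_le_norm_sum_le (hD : IsSqIntegrableMDS F μ D) {ε : ℝ} (hε : 0 < ε) (N : ℕ) :
    ENNReal.ofReal (ε ^ 2) * μ {ω | ∃ n ≤ N, ε ≤ ‖∑ k ∈ Finset.range n, D k ω‖}
      ≤ ∑ k ∈ Finset.range N, ENNReal.ofReal (∫ ω, ‖D k ω‖ ^ 2 ∂μ) := by
  set A : Set Ω := {ω | ∃ n ≤ N, ε ≤ ‖∑ k ∈ Finset.range n, D k ω‖}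
  have hmax := maximal_ineq hD.submartingale_norm_sq_sum
    (fun n ω => sq_nonneg _) (ε := (ε ^ 2).toNNReal) N
  have hA : {ω | ((ε ^ 2).toNNReal : ℝ) ≤
      (Finset.range (N + 1)).sup' Finset.nonempty_range_add_one
        fun k => ‖∑ i ∈ Finset.range k, D i ω‖ ^ 2} = A := by
    ext ω
    simp only [A, Set.mem_ofPred_eq, Finset.le_sup'_iff, Finset.mem_range, Nat.lt_succ_iff,
      Real.coe_toNNReal _ (sq_nonneg ε), pow_le_pow_iff_left₀ hε.le (norm_nonneg _) two_ne_zero]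
  rw [hA] at hmax
  calc ENNReal.ofReal (ε ^ 2) * μ A
      ≤ ENNReal.ofReal (∫ ω in A, ‖∑ k ∈ Finset.range N, D k ω‖ ^ 2 ∂μ) := hmax
    _ ≤ ENNReal.ofReal (∫ ω, ‖∑ k ∈ Finset.range N, D k ω‖ ^ 2 ∂μ) :=
        ENNReal.ofReal_le_ofReal (setIntegral_le_integral (hD.integrable_norm_sq_sum N)
          (ae_of_all _ fun _ => sq_nonneg _))
    _ = ∑ k ∈ Finset.range N, ENNReal.ofReal (∫ ω, ‖D k ω‖ ^ 2 ∂μ) := by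
        rw [hD.integral_norm_sq_sum, ENNReal.ofReal_sum_of_nonneg]
        exact fun k _ => integral_nonneg fun _ => sq_nonneg _

theorem measure_exists_le_norm_sum (hD : IsSqIntegrableMDS F μ D) {ε : ℝ} (hε : 0 < ε) :
    ENNReal.ofReal (ε ^ 2) * μ {ω | ∃ n, ε ≤ ‖∑ k ∈ Finset.range n, D k ω‖}
      ≤ ∑' k, ENNReal.ofReal (∫ ω, ‖D k ω‖ ^ 2 ∂μ) := by
  have hunion : {ω | ∃ n, ε ≤ ‖∑ k ∈ Finset.range n, D k ω‖}
      = ⋃ N, {ω | ∃ n ≤ N, ε ≤ ‖∑ k ∈ Finset.range n, D k ω‖} := by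
    ext ω
    simp only [Set.mem_ofPred_eq, Set.mem_iUnion]
    exact ⟨fun ⟨n, hn⟩ => ⟨n, n, le_rfl, hn⟩, fun ⟨_, n, _, hn⟩ => ⟨n, hn⟩⟩
  have hmono : Monotone fun N => {ω | ∃ n ≤ N, ε ≤ ‖∑ k ∈ Finset.range n, D k ω‖} :=
    fun N N' hN ω ⟨n, hn, h⟩ => ⟨n, hn.trans hN, h⟩
  rw [hunion, hmono.measure_iUnion, ENNReal.mul_iSup]
  exact iSup_le fun N =>
    (hD.measure_exists_le_norm_sum_le hε N).trans (ENNReal.sum_le_tsum _)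

end IsSqIntegrableMDS

variable [IsFiniteMeasure μ] [CompleteSpace E] {D : ℕ → ℕ → Ω → E} {b : ℕ → ℝ}

lemma measure_exists_le_norm_sum_tail (hD : ∀ j, IsSqIntegrableMDS F μ (D j))
    (hDb : ∀ k, ∑' j, ENNReal.ofReal (∫ ω, ‖D j k ω‖ ^ 2 ∂μ) ≤ ENNReal.ofReal (b k))
    {ε : ℝ} (hε : 0 < ε) (m : ℕ) :
    ENNReal.ofReal (ε ^ 2) * μ {ω | ∃ j n, ε ≤ ‖∑ k ∈ Finset.range n, D j (m + k) ω‖}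
      ≤ ∑' k, ENNReal.ofReal (b (k + m)) := by
  set B : ℕ → Set Ω := fun j => {ω | ∃ n, ε ≤ ‖∑ k ∈ Finset.range n, D j (m + k) ω‖}
  have hB : {ω | ∃ j n, ε ≤ ‖∑ k ∈ Finset.range n, D j (m + k) ω‖} = ⋃ j, B j := by
    ext ω; simp [B]
  calc ENNReal.ofReal (ε ^ 2) * μ {ω | ∃ j n, ε ≤ ‖∑ k ∈ Finset.range n, D j (m + k) ω‖}
      ≤ ENNReal.ofReal (ε ^ 2) * ∑' j, μ (B j) := by
        rw [hB]; gcongr; exact measure_iUnion_le _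
    _ = ∑' j, ENNReal.ofReal (ε ^ 2) * μ (B j) := ENNReal.tsum_mul_left.symm
    _ ≤ ∑' j, ∑' k, ENNReal.ofReal (∫ ω, ‖D j (m + k) ω‖ ^ 2 ∂μ) :=
        ENNReal.tsum_le_tsum fun j => ((hD j).shift m).measure_exists_le_norm_sum hε
    _ = ∑' k, ∑' j, ENNReal.ofReal (∫ ω, ‖D j (m + k) ω‖ ^ 2 ∂μ) := ENNReal.tsum_comm
    _ ≤ ∑' k, ENNReal.ofReal (b (k + m)) :=
        ENNReal.tsum_le_tsum fun k => by rw [add_comm k m]; exact hDb (m + k)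

lemma ae_exists_norm_sum_tail_lt (hD : ∀ j, IsSqIntegrableMDS F μ (D j)) (hb : Summable b)
    (hDb : ∀ k, ∑' j, ENNReal.ofReal (∫ ω, ‖D j k ω‖ ^ 2 ∂μ) ≤ ENNReal.ofReal (b k))
    {ε : ℝ} (hε : 0 < ε) :
    ∀ᵐ ω ∂μ, ∃ m, ∀ j n, ‖∑ k ∈ Finset.range n, D j (m + k) ω‖ < ε := by
  set B : ℕ → Set Ω := fun m => {ω | ∃ j n, ε ≤ ‖∑ k ∈ Finset.range n, D j (m + k) ω‖}
  have htail : Tendsto (fun m => ∑' k, ENNReal.ofReal (b (k + m))) atTop (𝓝 0) :=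
    ENNReal.tendsto_sum_nat_add _ hb.tsum_ofReal_ne_top
  have hle : ENNReal.ofReal (ε ^ 2) * μ (⋂ m, B m) ≤ 0 := ge_of_tendsto' htail fun m =>
    (mul_le_mul_right (measure_mono (Set.iInter_subset B m)) _).trans
      (measure_exists_le_norm_sum_tail hD hDb hε m)
  have hnull : μ (⋂ m, B m) = 0 := by simpa [hε.ne'] using hle
  rw [ae_iff]
  convert hnull using 2
  ext ω
  simp [B]

theorem ae_uniform_cauchy (hD : ∀ j, IsSqIntegrableMDS F μ (D j)) (hb : Summable b)
    (hDb : ∀ k, ∑' j, ENNReal.ofReal (∫ ω, ‖D j k ω‖ ^ 2 ∂μ) ≤ ENNReal.ofReal (b k)) :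
    ∀ᵐ ω ∂μ, ∀ ε : ℝ, 0 < ε → ∃ N, ∀ n, N ≤ n → ∀ n', n ≤ n' → ∀ j,
      ‖∑ k ∈ Finset.Ico n n', D j k ω‖ ≤ ε := by
  have hall : ∀ᵐ ω ∂μ, ∀ i : ℕ, ∃ m, ∀ j n,
      ‖∑ k ∈ Finset.range n, D j (m + k) ω‖ < 1 / ((i : ℝ) + 1) :=
    ae_all_iff.2 fun i => ae_exists_norm_sum_tail_lt hD hb hDb Nat.one_div_pos_of_nat
  filter_upwards [hall] with ω hω ε hε
  obtain ⟨i, hi⟩ := exists_nat_one_div_lt (half_pos hε)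
  obtain ⟨m, hm⟩ := hω i
  have hsum : ∀ j p, m ≤ p → ‖∑ k ∈ Finset.Ico m p, D j k ω‖ < ε / 2 := fun j p _ => by
    rw [Finset.sum_Ico_eq_sum_range]
    exact (hm j (p - m)).trans hi
  refine ⟨m, fun n hn n' hn' j => ?_⟩
  rw [eq_sub_of_add_eq' (Finset.sum_Ico_consecutive (fun k => D j k ω) hn hn')]
  exact (norm_sub_le _ _).trans (by linarith [hsum j n hn, hsum j n' (hn.trans hn')])

end InnerProductSpace

end MartingaleDifferences

section Noise

lemma sum_div_pow_of_le_pow_le {b V : ℝ} (hb : 1 < b) (hV : 0 ≤ V) (J : ℕ) :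
    ∑ j ∈ Finset.range J, (if V ≤ b ^ j then V / b ^ j else 0) ≤ b / (b - 1) := by
  have : 0 < b := zero_lt_one.trans hb
  have hb1 : 0 < b - 1 := sub_pos.2 hb
  set f : ℕ → ℝ := fun j => if V ≤ b ^ j then V / b ^ j else 0 with hf
  have hf0 (j : ℕ) : 0 ≤ f j := by simp only [hf]; split_ifs <;> positivity
  have hf1 (j : ℕ) : f j ≤ 1 := by
    simp only [hf]
    split_ifs with h
    exacts [(div_le_one (by positivity)).2 h, zero_le_one]
  -- From the first nonzero term on, the series is geometric with ratio `1 / b`.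
  have hstrong : ∑ j ∈ Finset.range J, f j + b / (b - 1) * f J ≤ b / (b - 1) := by
    induction J with
    | zero => simpa using mul_le_of_le_one_right (by positivity) (hf1 0)
    | succ J ih =>
      rw [Finset.sum_range_succ]
      by_cases hJ : V ≤ b ^ J
      · have hsucc : f (J + 1) = f J / b := by
          simp only [hf, if_pos hJ, if_pos (hJ.trans (pow_le_pow_right₀ hb.le J.le_succ)),
            pow_succ, div_div]
        refine le_of_eq_of_le ?_ ih
        rw [hsucc]
        field_simp
        ring
      · have hzero : ∀ j ≤ J, f j = 0 := fun j hj =>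
          if_neg fun h => hJ (h.trans (pow_le_pow_right₀ hb.le hj))
        rw [hzero J le_rfl, Finset.sum_eq_zero fun j hj => hzero j (Finset.mem_range.1 hj).le,
          add_zero, zero_add]
        exact mul_le_of_le_one_right (by positivity) (hf1 _)
  exact (le_add_of_nonneg_right (mul_nonneg (by positivity) (hf0 J))).trans hstrong

variable {Ω E : Type*} {mΩ : MeasurableSpace Ω} {μ : Measure Ω} {F : Filtration ℕ mΩ}
  [NormedAddCommGroup E]

/-- The conditional second moment of `D k` given the past `F k`. -/
noncomputable def condSecondMoment (F : Filtration ℕ mΩ) (μ : Measure Ω) (D : ℕ → Ω → E) (k : ℕ) :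
    Ω → ℝ :=
  μ[fun ω => ‖D k ω‖ ^ 2 | F k]

lemma measurableSet_condSecondMoment_le (D : ℕ → Ω → E) (k : ℕ) (r : ℝ) :
    MeasurableSet[F k] {ω | condSecondMoment F μ D k ω ≤ r} :=
  measurableSet_le stronglyMeasurable_condExp.measurable measurable_const

lemma condSecondMoment_nonneg (D : ℕ → Ω → E) (k : ℕ) : 0 ≤ᵐ[μ] condSecondMoment F μ D k :=
  condExp_nonneg (ae_of_all _ fun _ => sq_nonneg _)

section NormedSpace

variable [NormedSpace ℝ E]

/-- The weighted differences `a k • D k` seen at scale `2 ^ j`, and switched off where their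
conditional second moment is too large for that scale. Cutting on the conditional second moment,
which is known at time `k`, preserves the martingale difference property. -/
noncomputable def scaledNoise (F : Filtration ℕ mΩ) (μ : Measure Ω) (a : ℕ → ℝ) (D : ℕ → Ω → E)
    (j k : ℕ) : Ω → E :=
  (a k / 2 ^ j) • {ω | condSecondMoment F μ D k ω ≤ 4 ^ j}.indicator (D k)

namespace IsSqIntegrableMDS

variable {D : ℕ → Ω → E} [IsFiniteMeasure μ]

lemma integral_norm_sq_scaledNoise (hD : IsSqIntegrableMDS F μ D) (a : ℕ → ℝ) (j k : ℕ) :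
    ∫ ω, ‖scaledNoise F μ a D j k ω‖ ^ 2 ∂μ = a k ^ 2 * ∫ ω,
      (if condSecondMoment F μ D k ω ≤ 4 ^ j
        then condSecondMoment F μ D k ω / 4 ^ j else 0) ∂μ := by
  set s : Set Ω := {ω | condSecondMoment F μ D k ω ≤ 4 ^ j}
  have hs : MeasurableSet[F k] s := measurableSet_condSecondMoment_le D k (4 ^ j)
  have hpow : ((2 : ℝ) ^ j) ^ 2 = 4 ^ j := by rw [pow_right_comm]; norm_num
  have hnorm : (fun ω => ‖scaledNoise F μ a D j k ω‖ ^ 2)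
      = fun ω => a k ^ 2 / 4 ^ j * s.indicator (fun ω => ‖D k ω‖ ^ 2) ω := by
    funext ω
    by_cases hω : ω ∈ s
    · simp [scaledNoise, s, hω, norm_smul, mul_pow, div_pow, hpow]
    · simp [scaledNoise, s, hω]
  have hcond : (fun ω => if condSecondMoment F μ D k ω ≤ 4 ^ j
      then condSecondMoment F μ D k ω / 4 ^ j else 0)
      = fun ω => (4 ^ j)⁻¹ * s.indicator (condSecondMoment F μ D k) ω := by
    funext ω
    by_cases hω : condSecondMoment F μ D k ω ≤ 4 ^ j <;> simp [s, hω, div_eq_inv_mul]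
  rw [hnorm, hcond, integral_const_mul, integral_const_mul, integral_indicator (F.le k _ hs),
    integral_indicator (F.le k _ hs), condSecondMoment,
    setIntegral_condExp (F.le k) (hD.integrable_norm_sq k) hs]
  ring

lemma tsum_integral_norm_sq_scaledNoise_le (hD : IsSqIntegrableMDS F μ D) (a : ℕ → ℝ) (k : ℕ) :
    ∑' j, ENNReal.ofReal (∫ ω, ‖scaledNoise F μ a D j k ω‖ ^ 2 ∂μ)
      ≤ ENNReal.ofReal (μ.real Set.univ * (4 / (4 - 1)) * a k ^ 2) := by
  set V : Ω → ℝ := condSecondMoment F μ D k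
  have hint (j : ℕ) : Integrable (fun ω => if V ω ≤ 4 ^ j then V ω / 4 ^ j else 0) μ := by
    have hV : Integrable V μ := integrable_condExp
    have hs := F.le k _ (measurableSet_condSecondMoment_le (μ := μ) D k (4 ^ j))
    refine ((hV.div_const (4 ^ j)).indicator hs).congr (ae_of_all _ fun ω => ?_)
    simp [V, Set.indicator_apply]
  refine ENNReal.tsum_le_of_sum_range_le fun J => ?_
  rw [← ENNReal.ofReal_sum_of_nonneg fun j _ => integral_nonneg fun _ => sq_nonneg _]
  refine ENNReal.ofReal_le_ofReal ?_
  simp_rw [hD.integral_norm_sq_scaledNoise a]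
  rw [← Finset.mul_sum, mul_comm, ← integral_finsetSum _ fun j _ => hint j]
  refine mul_le_mul_of_nonneg_right ?_ (sq_nonneg _)
  calc ∫ ω, ∑ j ∈ Finset.range J, (if V ω ≤ 4 ^ j then V ω / 4 ^ j else 0) ∂μ
      ≤ ∫ _ : Ω, (4 / (4 - 1) : ℝ) ∂μ := by
        refine integral_mono_ae (integrable_finsetSum _ fun j _ => hint j) (integrable_const _) ?_
        filter_upwards [condSecondMoment_nonneg D k] with ω hω
        exact sum_div_pow_of_le_pow_le (by norm_num) hω J
    _ = μ.real Set.univ * (4 / (4 - 1)) := by rw [integral_const, smul_eq_mul]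

end IsSqIntegrableMDS

end NormedSpace

variable [InnerProductSpace ℝ E]

theorem IsSqIntegrableMDS.ae_norm_sum_smul_le [CompleteSpace E] [IsFiniteMeasure μ]
    {D : ℕ → Ω → E} (hD : IsSqIntegrableMDS F μ D) {a : ℕ → ℝ} (ha : Summable fun n => a n ^ 2) :
    ∀ᵐ ω ∂μ, ∀ ε : ℝ, 0 < ε → ∃ N, ∀ n, N ≤ n → ∀ n', n ≤ n' → ∀ R : ℝ, 1 ≤ R →
      (∀ k, n ≤ k → k < n' → condSecondMoment F μ D k ω ≤ R ^ 2) →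
        ‖∑ k ∈ Finset.Ico n n', a k • D k ω‖ ≤ ε * R := by
  have hmds (j : ℕ) : IsSqIntegrableMDS F μ (scaledNoise F μ a D j) :=
    hD.const_smul_indicator _ fun k => measurableSet_condSecondMoment_le D k (4 ^ j)
  filter_upwards [ae_uniform_cauchy hmds (ha.mul_left (μ.real Set.univ * (4 / (4 - 1))))
    (hD.tsum_integral_norm_sq_scaledNoise_le a)] with ω hω ε hε
  obtain ⟨N, hN⟩ := hω (ε / 2) (half_pos hε)
  refine ⟨N, fun n hn n' hn' R hR hV => ?_⟩
  obtain ⟨j, hjR, hRj⟩ := exists_nat_pow_near hR one_lt_two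
  have hscaled : ∀ k ∈ Finset.Ico n n',
      a k • D k ω = (2 : ℝ) ^ (j + 1) • scaledNoise F μ a D (j + 1) k ω := by
    intro k hk
    have hmem : ω ∈ {ω | condSecondMoment F μ D k ω ≤ 4 ^ (j + 1)} :=
      calc condSecondMoment F μ D k ω ≤ R ^ 2 :=
            hV k (Finset.mem_Ico.1 hk).1 (Finset.mem_Ico.1 hk).2
        _ ≤ (2 ^ (j + 1)) ^ 2 := by gcongr
        _ = 4 ^ (j + 1) := by rw [pow_right_comm]; norm_num
    rw [scaledNoise, Pi.smul_apply, Set.indicator_of_mem hmem, smul_smul,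
      mul_div_cancel₀ _ (by positivity)]
  calc ‖∑ k ∈ Finset.Ico n n', a k • D k ω‖
      = 2 ^ (j + 1) * ‖∑ k ∈ Finset.Ico n n', scaledNoise F μ a D (j + 1) k ω‖ := by
        rw [Finset.sum_congr rfl hscaled, ← Finset.smul_sum, norm_smul,
          Real.norm_of_nonneg (by positivity)]
    _ ≤ 2 * R * (ε / 2) := by
        rw [pow_succ']
        gcongr
        exact hN n hn n' hn' (j + 1)
    _ = ε * R := by ring

end Noise

section NoiseNegligible

/-- The noise is negligible at every scale: as long as the path `x` stays in the ball of radius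
`R ≥ 1`, the weighted noise accumulated from a late time on is at most `ε R`, uniformly in `R`. -/
def NoiseNegligible {E : Type*} [SeminormedAddCommGroup E] [NormedSpace ℝ E]
    (a : ℕ → ℝ) (x m : ℕ → E) : Prop :=
  ∀ ε : ℝ, 0 < ε → ∃ N, ∀ n, N ≤ n → ∀ n', n ≤ n' → ∀ R : ℝ, 1 ≤ R →
    (∀ k, n ≤ k → k < n' → ‖x k‖ ≤ R) → ‖∑ k ∈ Finset.Ico n n', a k • m (k + 1)‖ ≤ ε * R

variable {Ω : Type*} {d : ℕ}

lemma measurable_noise_succ (x₀ : Ω → State d) (M : ℕ → Ω → State d) (k : ℕ) :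
    Measurable[noiseSigma x₀ M (k + 1)] (M (k + 1)) :=
  measurable_iff_comap_le.2 (le_sup_of_le_right
    (le_iSup₂_of_le (k + 1) (Finset.mem_Icc.2 ⟨k.succ_pos, le_rfl⟩) le_rfl))

variable [mΩ : MeasurableSpace Ω]

/-- The filtration `σ(x₀, M₁, …, M_n)`. -/
def noiseFiltration {x₀ : Ω → State d} {M : ℕ → Ω → State d} (hx : Measurable x₀)
    (hM : ∀ n, Measurable (M (n + 1))) : Filtration ℕ mΩ where
  seq n := noiseSigma x₀ M n
  mono' _ _ hij := sup_le_sup_left (biSup_mono fun _ hk => Finset.Icc_subset_Icc_right hij hk) _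
  le' n := by
    refine sup_le hx.comap_le (iSup₂_le fun k hk => ?_)
    obtain ⟨l, rfl⟩ := Nat.exists_eq_add_of_le' (Finset.mem_Icc.1 hk).1
    exact (hM l).comap_le

variable {μ : Measure Ω} {x M : ℕ → Ω → State d}

lemma MartingaleNoise.isSqIntegrableMDS (hM : MartingaleNoise μ x M) :
    IsSqIntegrableMDS (noiseFiltration hM.measurable_init hM.measurable_noise) μ
      (fun k => M (k + 1)) where
  stronglyMeasurable k := (measurable_noise_succ (x 0) M k).stronglyMeasurable
  memLp := hM.sq_integrable
  condExp_eq_zero := hM.mds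

theorem MartingaleNoise.ae_noiseNegligible [IsFiniteMeasure μ] (hM : MartingaleNoise μ x M)
    {a : ℕ → ℝ} (ha : Summable fun n => a n ^ 2) :
    ∀ᵐ ω ∂μ, NoiseNegligible a (fun n => x n ω) (fun n => M n ω) := by
  obtain ⟨K, hK, hVK⟩ := hM.cond_sq_le
  filter_upwards [hM.isSqIntegrableMDS.ae_norm_sum_smul_le ha, ae_all_iff.2 hVK]
    with ω hω hV ε hε
  obtain ⟨b, hb⟩ : ∃ b, b = 1 + 2 * K := ⟨_, rfl⟩
  have hb1 : 1 ≤ b := by linarith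
  obtain ⟨N, hN⟩ := hω (ε / b) (by positivity)
  refine ⟨N, fun n hn n' hn' R hR hx => ?_⟩
  have hbR : 1 ≤ b * R := one_le_mul_of_one_le_of_one_le hb1 hR
  refine (hN n hn n' hn' (b * R) hbR fun k hk hk' => ?_).trans_eq (by field_simp)
  have hxR : ‖x k ω‖ ^ 2 ≤ R ^ 2 := by gcongr; exact hx k hk hk'
  calc μ[fun ω => ‖M (k + 1) ω‖ ^ 2 | noiseSigma (x 0) M k] ω
      ≤ K * (1 + ‖x k ω‖ ^ 2) := hV k
    _ ≤ K * (R ^ 2 + R ^ 2) := by gcongr; exact one_le_pow₀ hR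
    _ = (2 * K) * R ^ 2 := by ring
    _ ≤ b ^ 2 * R ^ 2 := by gcongr; nlinarith
    _ = (b * R) ^ 2 := by ring

end NoiseNegligible

section Clock

/-- The time `a 0 + ⋯ + a (n - 1)` at which the `n`-th iterate is reached. -/
noncomputable def clock (a : ℕ → ℝ) (n : ℕ) : ℝ := ∑ i ∈ Finset.range n, a i

/-- The first iterate reached at time `s` or later; it is meaningful when the times are
unbounded. -/
noncomputable def clockIndex (a : ℕ → ℝ) (s : ℝ) : ℕ := sInf {k | s ≤ clock a k}

lemma clock_succ (a : ℕ → ℝ) (n : ℕ) : clock a (n + 1) = clock a n + a n :=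
  Finset.sum_range_succ _ _

lemma sum_Ico_eq_clock_sub (a : ℕ → ℝ) {k l : ℕ} (h : k ≤ l) :
    ∑ j ∈ Finset.Ico k l, a j = clock a l - clock a k :=
  Finset.sum_Ico_eq_sub _ h

lemma clock_lt_of_lt_clockIndex {a : ℕ → ℝ} {s : ℝ} {k : ℕ} (h : k < clockIndex a s) :
    clock a k < s :=
  not_le.1 (Nat.notMem_of_lt_sInf h)

lemma clockIndex_le {a : ℕ → ℝ} {s : ℝ} {k : ℕ} (h : s ≤ clock a k) : clockIndex a s ≤ k :=
  Nat.sInf_le (s := {k | s ≤ clock a k}) h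

namespace StepSizes

variable {a : ℕ → ℝ}

lemma clock_strictMono (ha : StepSizes a) : StrictMono (clock a) :=
  strictMono_nat_of_lt_succ fun n => by rw [clock_succ]; linarith [ha.pos n]

lemma tendsto_zero (ha : StepSizes a) : Tendsto a atTop (𝓝 0) := by
  simpa [Real.sqrt_sq (ha.pos _).le] using ha.sq_summable.tendsto_atTop_zero.sqrt

lemma le_clock_clockIndex (ha : StepSizes a) (s : ℝ) : s ≤ clock a (clockIndex a s) :=
  Nat.sInf_mem (s := {k | s ≤ clock a k}) (ha.sum_diverges.eventually_ge_atTop s).exists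

lemma clockIndex_clock (ha : StepSizes a) (n : ℕ) : clockIndex a (clock a n) = n :=
  le_antisymm (clockIndex_le le_rfl) (ha.clock_strictMono.le_iff_le.1 (ha.le_clock_clockIndex _))

lemma clockIndex_mono (ha : StepSizes a) : Monotone (clockIndex a) := fun _ _ h =>
  clockIndex_le (h.trans (ha.le_clock_clockIndex _))

lemma le_clockIndex_add (ha : StepSizes a) (n : ℕ) {s : ℝ} (hs : 0 ≤ s) :
    n ≤ clockIndex a (clock a n + s) :=
  (ha.clockIndex_clock n).symm.trans_le (ha.clockIndex_mono (le_add_of_nonneg_right hs))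

lemma lt_clockIndex_add (ha : StepSizes a) (n : ℕ) {s : ℝ} (hs : 0 < s) :
    n < clockIndex a (clock a n + s) :=
  ha.clock_strictMono.lt_iff_lt.1 ((lt_add_of_pos_right _ hs).trans_le (ha.le_clock_clockIndex _))

lemma eventually_clock_clockIndex_lt (ha : StepSizes a) {η : ℝ} (hη : 0 < η) :
    ∀ᶠ n in atTop, ∀ s, 0 ≤ s → clock a (clockIndex a (clock a n + s)) < clock a n + s + η := by
  obtain ⟨N, hN⟩ := eventually_atTop.1 (ha.tendsto_zero.eventually_lt_const hη)
  filter_upwards [eventually_ge_atTop N] with n hn s hs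
  rcases hs.eq_or_lt with rfl | hs
  · rw [add_zero, ha.clockIndex_clock]
    exact lt_add_of_pos_right _ hη
  · have hlt := ha.lt_clockIndex_add n hs
    obtain ⟨k, hk⟩ := Nat.exists_eq_add_one.2 (Nat.zero_lt_of_lt hlt)
    have hks : clock a k < clock a n + s := clock_lt_of_lt_clockIndex (hk ▸ k.lt_succ_self)
    rw [hk, clock_succ]
    linarith [hN k (by omega)]

lemma exists_jump_start (ha : StepSizes a) {T : ℝ} (hT : 0 < T) {P : ℕ → Prop} {n₀ : ℕ}
    (h₀ : P n₀) (hjump : ∀ n, n₀ ≤ n → P n → P (clockIndex a (clock a n + T))) {k : ℕ}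
    (hk : n₀ ≤ k) : ∃ n, n₀ ≤ n ∧ n ≤ k ∧ P n ∧ clock a k < clock a n + T := by
  classical
  set n := Nat.findGreatest (fun n => n₀ ≤ n ∧ P n) k
  obtain ⟨hn, hPn⟩ : n₀ ≤ n ∧ P n :=
    Nat.findGreatest_spec (P := fun n => n₀ ≤ n ∧ P n) hk ⟨le_rfl, h₀⟩
  refine ⟨n, hn, Nat.findGreatest_le k, hPn, not_le.1 fun hle => ?_⟩
  have hlt := ha.lt_clockIndex_add n hT
  exact (Nat.le_findGreatest (P := fun n => n₀ ≤ n ∧ P n) (clockIndex_le hle)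
    ⟨hn.trans hlt.le, hjump n hn hPn⟩).not_gt hlt

end StepSizes

lemma norm_sum_smul_le_mul_clock_sub {E : Type*} [SeminormedAddCommGroup E] [NormedSpace ℝ E]
    {a : ℕ → ℝ} (ha : ∀ n, 0 ≤ a n) {v : ℕ → E} {L : ℝ} {k l : ℕ} (hkl : k ≤ l)
    (hv : ∀ j ∈ Finset.Ico k l, ‖v j‖ ≤ L) :
    ‖∑ j ∈ Finset.Ico k l, a j • v j‖ ≤ L * (clock a l - clock a k) := by
  rw [← sum_Ico_eq_clock_sub a hkl, mul_comm, Finset.sum_mul]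
  refine norm_sum_le_of_le _ fun j hj => ?_
  rw [norm_smul, Real.norm_of_nonneg (ha j)]
  exact mul_le_mul_of_nonneg_left (hv j hj) (ha j)

end Clock

section PerturbedEuler

variable {E : Type*} [SeminormedAddCommGroup E] [NormedSpace ℝ E] {a : ℕ → ℝ} {x y m : ℕ → E}

/-- A path of the recursion `x_{n+1} = x_n + a(n) (y_n + m_{n+1})` whose drift `y` has linear
growth and whose noise `m` is negligible. -/
structure IsPerturbedEuler (a : ℕ → ℝ) (x y m : ℕ → E) : Prop where
  stepSizes : StepSizes a
  step : ∀ n, x (n + 1) = x n + a n • (y n + m (n + 1))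
  growth : ∃ K : ℝ, 0 < K ∧ ∀ n, ‖y n‖ ≤ K * (1 + ‖x n‖)
  noise : NoiseNegligible a x m

namespace IsPerturbedEuler

lemma sub_eq (hp : IsPerturbedEuler a x y m) {k l : ℕ} (hkl : k ≤ l) :
    x l - x k = ∑ j ∈ Finset.Ico k l, a j • y j + ∑ j ∈ Finset.Ico k l, a j • m (j + 1) := by
  rw [← Finset.sum_add_distrib, ← Finset.sum_Ico_sub x hkl]
  refine Finset.sum_congr rfl fun j _ => ?_
  rw [hp.step, smul_add, add_sub_cancel_left]

/- Subtracting the accumulated noise from the path leaves a sequence to which the discrete Gronwall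
argument applies. -/
lemma norm_sub_noise_le_exp_mul (hp : IsPerturbedEuler a x y m) {K r : ℝ} (hK : 0 ≤ K)
    (hy : ∀ n, ‖y n‖ ≤ K * (1 + ‖x n‖)) {n k : ℕ} (hnk : n ≤ k)
    (hr : ∀ l, n ≤ l → l ≤ k → ‖∑ j ∈ Finset.Ico n l, a j • m (j + 1)‖ ≤ r) :
    1 + r + ‖x k - ∑ j ∈ Finset.Ico n k, a j • m (j + 1)‖
      ≤ Real.exp (K * (clock a k - clock a n)) * (1 + r + ‖x n‖) := by
  induction k, hnk using Nat.le_induction with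
  | base => simp
  | succ k hnk ih =>
    have ih := ih fun l hnl hlk => hr l hnl (hlk.trans k.le_succ)
    set z := ∑ j ∈ Finset.Ico n k, a j • m (j + 1) with hz
    have hak := (hp.stepSizes.pos k).le
    have hstep : x (k + 1) - ∑ j ∈ Finset.Ico n (k + 1), a j • m (j + 1)
        = (x k - z) + a k • y k := by
      rw [Finset.sum_Ico_succ_top hnk, hp.step, smul_add, ← hz]
      abel
    have hxk : ‖x k‖ ≤ r + ‖x k - z‖ := by
      have hzr : ‖z‖ ≤ r := hr k hnk k.le_succ
      linarith [norm_le_norm_add_norm_sub' (x k) z]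
    have hyk : ‖a k • y k‖ ≤ a k * (K * (1 + r + ‖x k - z‖)) := by
      rw [norm_smul, Real.norm_of_nonneg hak]
      gcongr
      exact (hy k).trans (mul_le_mul_of_nonneg_left (by linarith) hK)
    calc 1 + r + ‖x (k + 1) - ∑ j ∈ Finset.Ico n (k + 1), a j • m (j + 1)‖
        ≤ (K * a k + 1) * (1 + r + ‖x k - z‖) := by
          rw [hstep]
          linarith [norm_add_le (x k - z) (a k • y k)]
      _ ≤ Real.exp (K * a k) * (Real.exp (K * (clock a k - clock a n)) * (1 + r + ‖x n‖)) := by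
          have : 0 ≤ r := (norm_nonneg z).trans (hr k hnk k.le_succ)
          gcongr
          exact Real.add_one_le_exp _
      _ = Real.exp (K * (clock a (k + 1) - clock a n)) * (1 + r + ‖x n‖) := by
          rw [← mul_assoc, ← Real.exp_add, clock_succ]
          ring_nf

lemma norm_le_exp_mul (hp : IsPerturbedEuler a x y m) {K r : ℝ} (hK : 0 ≤ K)
    (hy : ∀ n, ‖y n‖ ≤ K * (1 + ‖x n‖)) {n k : ℕ} (hnk : n ≤ k)
    (hr : ∀ l, n ≤ l → l ≤ k → ‖∑ j ∈ Finset.Ico n l, a j • m (j + 1)‖ ≤ r) :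
    ‖x k‖ ≤ Real.exp (K * (clock a k - clock a n)) * (1 + r + ‖x n‖) := by
  have hle := hp.norm_sub_noise_le_exp_mul hK hy hnk hr
  linarith [hr k hnk le_rfl,
    norm_le_norm_add_norm_sub' (x k) (∑ j ∈ Finset.Ico n k, a j • m (j + 1))]

theorem exists_norm_le_mul_max (hp : IsPerturbedEuler a x y m) (T : ℝ) :
    ∃ C : ℝ, 1 ≤ C ∧ ∀ᶠ n in atTop, ∀ k, n ≤ k → clock a k ≤ clock a n + T →
      ‖x k‖ ≤ C * max 1 ‖x n‖ := by
  obtain ⟨K, hK, hy⟩ := hp.growth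
  set C : ℝ := 3 * Real.exp (K * max 0 T) with hC
  have hC1 : 1 ≤ C := by linarith [Real.one_le_exp (mul_nonneg hK.le (le_max_left 0 T))]
  obtain ⟨N, hN⟩ := hp.noise C⁻¹ (by positivity)
  refine ⟨C, hC1, eventually_atTop.2 ⟨N, fun n hn k => ?_⟩⟩
  set r := max 1 ‖x n‖
  have hr1 : 1 ≤ r := le_max_left _ _
  -- The bound up to time `k` keeps the noise below `r`, which gives the bound at `k`.
  induction k using Nat.strong_induction_on with
  | _ k ih =>
    intro hnk hkT
    have hnoise : ∀ l, n ≤ l → l ≤ k → ‖∑ j ∈ Finset.Ico n l, a j • m (j + 1)‖ ≤ r := by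
      intro l hnl hlk
      refine (hN n hn l hnl (C * r) (one_le_mul_of_one_le_of_one_le hC1 hr1) fun j hj hjl => ?_)
        |>.trans_eq (inv_mul_cancel_left₀ (by positivity) r)
      exact ih j (hjl.trans_le hlk) hj
        ((hp.stepSizes.clock_strictMono.monotone (hjl.le.trans hlk)).trans hkT)
    calc ‖x k‖ ≤ Real.exp (K * (clock a k - clock a n)) * (1 + r + ‖x n‖) :=
          hp.norm_le_exp_mul hK.le hy hnk hnoise
      _ ≤ Real.exp (K * max 0 T) * (r + r + r) := by
          gcongr
          · linarith [le_max_right 0 T]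
          · exact le_max_right _ _
      _ = C * r := by rw [hC]; ring

end IsPerturbedEuler

end PerturbedEuler

section AsymptoticallyLipschitz

variable {ι X Y : Type*} [PseudoMetricSpace X] [PseudoMetricSpace Y] {l : Filter ι}
  {f : ι → X → Y} {g : X → Y} {L : NNReal} {s : Set X}

/-- Along `l`, the functions `f i` are `L`-Lipschitz on `s` up to an error tending to zero. It
replaces equicontinuity for step functions. -/
def AsymptoticallyLipschitzOn (f : ι → X → Y) (l : Filter ι) (L : NNReal) (s : Set X) : Prop :=
  ∀ ε : ℝ, 0 < ε → ∀ᶠ i in l, ∀ u ∈ s, ∀ v ∈ s, dist (f i u) (f i v) ≤ L * dist u v + ε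

namespace AsymptoticallyLipschitzOn

lemma lipschitzOnWith [l.NeBot] (hf : AsymptoticallyLipschitzOn f l L s)
    (hg : ∀ u ∈ s, Tendsto (f · u) l (𝓝 (g u))) : LipschitzOnWith L g s := by
  refine LipschitzOnWith.of_dist_le_mul fun u hu v hv => le_of_forall_pos_le_add fun ε hε => ?_
  refine le_of_tendsto ((hg u hu).dist (hg v hv)) ?_
  filter_upwards [hf ε hε] with i hi using hi u hu v hv

lemma tendstoUniformlyOn [l.NeBot] (hf : AsymptoticallyLipschitzOn f l L s)
    (hg : ∀ u ∈ s, Tendsto (f · u) l (𝓝 (g u))) (hs : IsCompact s) :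
    TendstoUniformlyOn f g l s := by
  rw [← tendstoLocallyUniformlyOn_iff_tendstoUniformlyOn_of_compact hs,
    Metric.tendstoLocallyUniformlyOn_iff]
  intro ε hε u hu
  obtain ⟨δ, hδ, hLδ⟩ := exists_pos_mul_lt (show 0 < ε / 4 by positivity) (L : ℝ)
  refine ⟨Metric.ball u δ ∩ s, Filter.inter_mem
    (mem_nhdsWithin_of_mem_nhds (Metric.ball_mem_nhds u hδ)) self_mem_nhdsWithin, ?_⟩
  filter_upwards [hf (ε / 4) (by positivity),
    Metric.tendsto_nhds.1 (hg u hu) (ε / 4) (by positivity)] with i hi hiu v ⟨hvu, hv⟩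
  have hLvu : L * dist v u ≤ ε / 4 :=
    (mul_le_mul_of_nonneg_left (Metric.mem_ball.1 hvu).le L.2).trans hLδ.le
  have hgvu := (hf.lipschitzOnWith hg).dist_le_mul v hv u hu
  have hfvu := hi v hv u hu
  linarith [dist_triangle4_right (g v) (f i v) (g u) (f i u), dist_comm (g u) (f i u)]

end AsymptoticallyLipschitzOn

end AsymptoticallyLipschitz

section RescaledWindows

variable {E : Type*} [SeminormedAddCommGroup E] {a : ℕ → ℝ} {x y m : ℕ → E}
  {ι : Type*} {l : Filter ι} {n : ι → ℕ} {c : ι → ℝ}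

/-- The starting indices `n i` tend to infinity, and on windows of bounded length after them the
path is of order `c i`, so that its rescalings by `(c i)⁻¹` stay bounded. -/
structure IsRescaledWindow (a : ℕ → ℝ) (x : ℕ → E) (l : Filter ι) (n : ι → ℕ) (c : ι → ℝ) :
    Prop where
  tendsto_start : Tendsto n l atTop
  one_le_scale : ∀ᶠ i in l, 1 ≤ c i
  bounded : ∀ T : ℝ, ∃ C : ℝ, 1 ≤ C ∧ ∀ᶠ i in l, ∀ k, n i ≤ k → clock a k ≤ clock a (n i) + T →
    ‖x k‖ ≤ C * c i

namespace IsRescaledWindow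

lemma eventually_clock_lt (hw : IsRescaledWindow a x l n c) (ha : StepSizes a) {η : ℝ}
    (hη : 0 < η) : ∀ᶠ i in l, ∀ s, 0 ≤ s →
      clock a (clockIndex a (clock a (n i) + s)) < clock a (n i) + s + η :=
  hw.tendsto_start.eventually (ha.eventually_clock_clockIndex_lt hη)

lemma tendsto_clock_sub (hw : IsRescaledWindow a x l n c) (ha : StepSizes a) {s s' : ℝ}
    (hs : 0 ≤ s) (hs' : 0 ≤ s') :
    Tendsto (fun i => clock a (clockIndex a (clock a (n i) + s'))
      - clock a (clockIndex a (clock a (n i) + s))) l (𝓝 (s' - s)) := by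
  rw [Metric.tendsto_nhds]
  intro η hη
  filter_upwards [hw.eventually_clock_lt ha hη] with i hclock
  rw [Real.dist_eq, abs_lt]
  constructor <;> linarith [hclock s hs, hclock s' hs',
    ha.le_clock_clockIndex (clock a (n i) + s), ha.le_clock_clockIndex (clock a (n i) + s')]

end IsRescaledWindow

variable [NormedSpace ℝ E]

lemma norm_inv_smul_le_iff {c r : ℝ} (hc : 0 < c) (v : E) : ‖c⁻¹ • v‖ ≤ r ↔ ‖v‖ ≤ c * r := by
  rw [norm_smul, norm_inv, Real.norm_of_nonneg hc.le, inv_mul_le_iff₀ hc]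

/-- The path started at the `n`-th iterate, in continuous time and scaled by `c⁻¹`. -/
noncomputable def rescaledPath (a : ℕ → ℝ) (x : ℕ → E) (n : ℕ) (c s : ℝ) : E :=
  c⁻¹ • x (clockIndex a (clock a n + s))

lemma rescaledPath_clock_sub (ha : StepSizes a) (x : ℕ → E) (n : ℕ) (c : ℝ) (j : ℕ) :
    rescaledPath a x n c (clock a j - clock a n) = c⁻¹ • x j := by
  rw [rescaledPath, add_sub_cancel, ha.clockIndex_clock]

lemma rescaledPath_zero (ha : StepSizes a) (x : ℕ → E) (n : ℕ) (c : ℝ) :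
    rescaledPath a x n c 0 = c⁻¹ • x n := by
  rw [rescaledPath, add_zero, ha.clockIndex_clock]

lemma IsPerturbedEuler.rescaledPath_sub (hp : IsPerturbedEuler a x y m) (n : ℕ) (c : ℝ) {s s' : ℝ}
    (hs : s ≤ s') :
    rescaledPath a x n c s' - rescaledPath a x n c s =
      ∑ j ∈ Finset.Ico (clockIndex a (clock a n + s)) (clockIndex a (clock a n + s')),
        a j • (c⁻¹ • y j) +
      c⁻¹ • ∑ j ∈ Finset.Ico (clockIndex a (clock a n + s)) (clockIndex a (clock a n + s')),
        a j • m (j + 1) := by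
  rw [rescaledPath, rescaledPath, ← smul_sub,
    hp.sub_eq (hp.stepSizes.clockIndex_mono (by linarith)), smul_add, Finset.smul_sum]
  simp_rw [smul_comm c⁻¹ (a _)]

namespace IsRescaledWindow

lemma of_norm_start_le (hp : IsPerturbedEuler a x y m) (hn : Tendsto n l atTop)
    (hc : ∀ᶠ i in l, 1 ≤ c i) (hxc : ∀ᶠ i in l, ‖x (n i)‖ ≤ c i) :
    IsRescaledWindow a x l n c where
  tendsto_start := hn
  one_le_scale := hc
  bounded T := by
    obtain ⟨C, hC1, hC⟩ := hp.exists_norm_le_mul_max T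
    refine ⟨C, hC1, ?_⟩
    filter_upwards [hn.eventually hC, hc, hxc] with i hi hci hxi k hk hkT
    exact (hi k hk hkT).trans
      (mul_le_mul_of_nonneg_left (max_le hci hxi) (zero_le_one.trans hC1))

lemma eventually_norm_rescaledPath_le (hw : IsRescaledWindow a x l n c) (ha : StepSizes a)
    (T : ℝ) : ∃ C : ℝ, ∀ᶠ i in l, ∀ s ∈ Set.Icc 0 T, ‖rescaledPath a x (n i) (c i) s‖ ≤ C := by
  obtain ⟨C, -, hC⟩ := hw.bounded (T + 1)
  refine ⟨C, ?_⟩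
  filter_upwards [hC, hw.eventually_clock_lt ha one_pos, hw.one_le_scale] with i hi hclock hci s hs
  rw [rescaledPath, norm_inv_smul_le_iff (one_pos.trans_le hci), mul_comm]
  exact hi _ (ha.le_clockIndex_add _ hs.1) (by linarith [hclock s hs.1, hs.2])

lemma eventually_norm_drift_le (hw : IsRescaledWindow a x l n c) (hp : IsPerturbedEuler a x y m)
    (T : ℝ) : ∃ L : NNReal, ∀ᶠ i in l, ∀ j, n i ≤ j → clock a j ≤ clock a (n i) + T →
      ‖(c i)⁻¹ • y j‖ ≤ L := by
  obtain ⟨K, hK, hy⟩ := hp.growth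
  obtain ⟨C, hC1, hC⟩ := hw.bounded T
  refine ⟨⟨K * (1 + C), by positivity⟩, ?_⟩
  filter_upwards [hC, hw.one_le_scale] with i hi hci j hj hjT
  rw [norm_inv_smul_le_iff (one_pos.trans_le hci)]
  calc ‖y j‖ ≤ K * (1 + ‖x j‖) := hy j
    _ ≤ K * (c i + C * c i) := by gcongr; exact hi j hj hjT
    _ = c i * (K * (1 + C)) := by ring

lemma eventually_norm_noise_le (hw : IsRescaledWindow a x l n c) (hp : IsPerturbedEuler a x y m)
    (T : ℝ) {ε : ℝ} (hε : 0 < ε) :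
    ∀ᶠ i in l, ∀ k k', n i ≤ k → k ≤ k' → clock a k' ≤ clock a (n i) + T →
      ‖(c i)⁻¹ • ∑ j ∈ Finset.Ico k k', a j • m (j + 1)‖ ≤ ε := by
  obtain ⟨C, hC1, hC⟩ := hw.bounded T
  obtain ⟨N, hN⟩ := hp.noise (ε / C) (by positivity)
  filter_upwards [hC, hw.tendsto_start.eventually_ge_atTop N, hw.one_le_scale]
    with i hi hni hci k k' hk hkk' hT
  rw [norm_inv_smul_le_iff (one_pos.trans_le hci)]
  calc ‖∑ j ∈ Finset.Ico k k', a j • m (j + 1)‖ ≤ ε / C * (C * c i) :=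
        hN k (hni.trans hk) k' hkk' _ (one_le_mul_of_one_le_of_one_le hC1 hci) fun j hj hjk' =>
          hi j (hk.trans hj) ((hp.stepSizes.clock_strictMono.monotone hjk'.le).trans hT)
    _ = c i * ε := by field_simp

lemma asymptoticallyLipschitzOn (hw : IsRescaledWindow a x l n c)
    (hp : IsPerturbedEuler a x y m) (T : ℝ) : ∃ L : NNReal,
      AsymptoticallyLipschitzOn (fun i => rescaledPath a x (n i) (c i)) l L (Set.Icc 0 T) := by
  have ha := hp.stepSizes
  obtain ⟨L, hL⟩ := hw.eventually_norm_drift_le hp (T + 1)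
  refine ⟨L, fun ε hε => ?_⟩
  obtain ⟨η, hη, hLη⟩ := exists_pos_mul_lt (half_pos hε) (L : ℝ)
  filter_upwards [hL, hw.eventually_clock_lt ha one_pos, hw.eventually_clock_lt ha hη,
    hw.eventually_norm_noise_le hp (T + 1) (half_pos hε)] with i hdrift hclock hclockη hnoise
  intro s hs s' hs'
  wlog hss' : s ≤ s' generalizing s s'
  · rw [dist_comm, dist_comm s]
    exact this s' hs' s hs (le_of_not_ge hss')
  set k := clockIndex a (clock a (n i) + s)
  set k' := clockIndex a (clock a (n i) + s')
  have hnk : n i ≤ k := ha.le_clockIndex_add _ hs.1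
  have hkk' : k ≤ k' := ha.clockIndex_mono (by linarith)
  have hk'T : clock a k' ≤ clock a (n i) + (T + 1) := by linarith [hclock s' hs'.1, hs'.2]
  have hclock_sub : clock a k' - clock a k ≤ (s' - s) + η := by
    linarith [hclockη s' hs'.1, ha.le_clock_clockIndex (clock a (n i) + s)]
  have hdrift_sum : ‖∑ j ∈ Finset.Ico k k', a j • ((c i)⁻¹ • y j)‖ ≤ L * ((s' - s) + η) := by
    refine (norm_sum_smul_le_mul_clock_sub (fun j => (ha.pos j).le) hkk' fun j hj => ?_).trans
      (mul_le_mul_of_nonneg_left hclock_sub L.2)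
    rw [Finset.mem_Ico] at hj
    exact hdrift j (hnk.trans hj.1) ((ha.clock_strictMono.monotone hj.2.le).trans hk'T)
  rw [dist_comm, dist_eq_norm, hp.rescaledPath_sub _ _ hss', dist_comm s, Real.dist_eq,
    abs_of_nonneg (sub_nonneg.2 hss')]
  linarith [norm_add_le_of_le hdrift_sum (hnoise k k' hnk hkk' hk'T)]

theorem exists_tendstoUniformlyOn [ProperSpace E] {U : Ultrafilter ι}
    (hw : IsRescaledWindow a x U n c) (hp : IsPerturbedEuler a x y m) :
    ∃ φ : ℝ → E, (∀ T : ℝ, ∃ L : NNReal, LipschitzOnWith L φ (Set.Icc 0 T)) ∧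
      ∀ T : ℝ, TendstoUniformlyOn (fun i => rescaledPath a x (n i) (c i)) φ U (Set.Icc 0 T) := by
  have hlim : ∀ s : ℝ, ∃ p, 0 ≤ s →
      Tendsto (fun i => rescaledPath a x (n i) (c i) s) U (𝓝 p) := by
    intro s
    rcases lt_or_ge s 0 with hs | hs
    · exact ⟨0, fun h => absurd h hs.not_ge⟩
    obtain ⟨C, hC⟩ := hw.eventually_norm_rescaledPath_le hp.stepSizes s
    have hball : ∀ᶠ i in (U : Filter ι),
        rescaledPath a x (n i) (c i) s ∈ Metric.closedBall (0 : E) C := by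
      filter_upwards [hC] with i hi using mem_closedBall_zero_iff.2 (hi s ⟨hs, le_rfl⟩)
    obtain ⟨p, -, hp⟩ := (isCompact_closedBall (0 : E) C).ultrafilter_le_nhds
      (U.map fun i => rescaledPath a x (n i) (c i) s) (le_principal_iff.2 hball)
    exact ⟨p, fun _ => hp⟩
  choose φ hφ using hlim
  refine ⟨φ, fun T => ?_, fun T => ?_⟩ <;>
    obtain ⟨L, hL⟩ := hw.asymptoticallyLipschitzOn hp T
  · exact ⟨L, hL.lipschitzOnWith fun s hs => hφ s hs.1⟩
  · exact hL.tendstoUniformlyOn (fun s hs => hφ s hs.1) isCompact_Icc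

lemma tendsto_noise (hw : IsRescaledWindow a x l n c) (hp : IsPerturbedEuler a x y m) {s s' : ℝ}
    (hs : 0 ≤ s) (hss' : s ≤ s') :
    Tendsto (fun i => (c i)⁻¹ • ∑ j ∈ Finset.Ico (clockIndex a (clock a (n i) + s))
      (clockIndex a (clock a (n i) + s')), a j • m (j + 1)) l (𝓝 0) := by
  rw [Metric.tendsto_nhds]
  intro η hη
  filter_upwards [hw.eventually_norm_noise_le hp (s' + 1) (half_pos hη),
    hw.eventually_clock_lt hp.stepSizes one_pos] with i hnoise hclock
  rw [dist_zero_right]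
  exact (hnoise _ _ (hp.stepSizes.le_clockIndex_add _ hs)
    (hp.stepSizes.clockIndex_mono (by linarith))
    (by linarith [hclock s' (hs.trans hss')])).trans_lt (half_lt_self hη)

/- Without the noise, the increment of the path over `[s, s']` divided by the elapsed clock time is
a convex combination of rescaled drifts. -/
theorem inv_smul_sub_mem (hw : IsRescaledWindow a x l n c) (hp : IsPerturbedEuler a x y m)
    [l.NeBot] {Q : Set E} (hQ : IsClosed Q) (hQc : Convex ℝ Q) {s s' : ℝ} (hs : 0 ≤ s)
    (hss' : s < s') {p p' : E}
    (hsp : Tendsto (fun i => rescaledPath a x (n i) (c i) s) l (𝓝 p))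
    (hsp' : Tendsto (fun i => rescaledPath a x (n i) (c i) s') l (𝓝 p'))
    (hmem : ∀ᶠ i in l, ∀ j, clock a j - clock a (n i) ∈ Set.Ico s s' → (c i)⁻¹ • y j ∈ Q) :
    (s' - s)⁻¹ • (p' - p) ∈ Q := by
  have ha := hp.stepSizes
  have hpos := sub_pos.2 hss'
  have hclock := hw.tendsto_clock_sub ha hs (hs.trans hss'.le)
  have hlim := (hclock.inv₀ hpos.ne').smul ((hsp'.sub hsp).sub (hw.tendsto_noise hp hs hss'.le))
  rw [sub_zero] at hlim
  refine hQ.mem_of_tendsto hlim ?_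
  filter_upwards [hmem, hclock.eventually_const_lt hpos] with i hi hclock_pos
  set k := clockIndex a (clock a (n i) + s)
  set k' := clockIndex a (clock a (n i) + s')
  rw [hp.rescaledPath_sub _ _ hss'.le, add_sub_cancel_right, Finset.smul_sum]
  simp_rw [smul_smul (clock a k' - clock a k)⁻¹]
  refine hQc.sum_mem (fun j _ => mul_nonneg (inv_nonneg.2 hclock_pos.le) (ha.pos j).le) ?_
    fun j hj => hi j ?_
  · rw [← Finset.mul_sum, sum_Ico_eq_clock_sub a (ha.clockIndex_mono (by linarith)),
      inv_mul_cancel₀ hclock_pos.ne']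
  · rw [Finset.mem_Ico] at hj
    have hkj := (ha.le_clock_clockIndex _).trans (ha.clock_strictMono.monotone hj.1)
    have hjk' := clock_lt_of_lt_clockIndex hj.2
    constructor <;> linarith

end IsRescaledWindow

end RescaledWindows

section LimitingInclusion

variable {d : ℕ} {h H : State d → Set (State d)}

theorem isSolution_of_right_quotients {φ : ℝ → State d} (hclosed : ∀ z, IsClosed (H z))
    (hlip : ∀ T : ℝ, ∃ L : NNReal, LipschitzOnWith L φ (Set.Icc 0 T))
    (hquot : ∀ t, 0 < t → ∀ ε : ℝ, 0 < ε →
      ∀ᶠ s in 𝓝[>] t, (s - t)⁻¹ • (φ s - φ t) ∈ Metric.cthickening ε (H (φ t))) :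
    IsSolution H φ where
  absCont T hT := by
    obtain ⟨L, hL⟩ := hlip T
    exact LipschitzOnWith.absolutelyContinuousOnInterval (by rwa [Set.uIcc_of_le hT])
  inclusion := by
    have hdiff : ∀ᵐ t : ℝ, ∀ N : ℕ, t ∈ Set.Icc (0 : ℝ) N →
        DifferentiableWithinAt ℝ φ (Set.Icc 0 (N : ℝ)) t := ae_all_iff.2 fun N => by
      obtain ⟨L, hL⟩ := hlip N
      exact hL.ae_differentiableWithinAt_of_mem_real
    filter_upwards [ae_restrict_of_ae hdiff, ae_restrict_mem measurableSet_Ioi] with t ht ht0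
    rw [Set.mem_Ioi] at ht0
    obtain ⟨N, hN⟩ := exists_nat_gt t
    have hd : DifferentiableAt ℝ φ t :=
      (ht N ⟨ht0.le, hN.le⟩).differentiableAt (Icc_mem_nhds ht0 hN)
    refine ⟨deriv φ t, ?_, hd.hasDerivAt⟩
    have hslope : Tendsto (slope φ t) (𝓝[>] t) (𝓝 (deriv φ t)) :=
      (hasDerivAt_iff_tendsto_slope.1 hd.hasDerivAt).mono_left
        (nhdsWithin_mono _ fun s hs => ne_of_gt hs)
    rw [← (hclosed (φ t)).closure_eq, Metric.closure_eq_iInter_cthickening]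
    refine Set.mem_iInter₂.2 fun ε hε => Metric.isClosed_cthickening.mem_of_tendsto hslope ?_
    filter_upwards [hquot t ht0 ε hε] with s hs
    rwa [slope_def_module]

/-- The maps `G i` are upper semicontinuous in the limit along `l`: locally uniformly, their values
are eventually as close as desired to the values of `H`. -/
def TendstoUpper {ι : Type*} (G : ι → State d → Set (State d)) (l : Filter ι)
    (H : State d → Set (State d)) : Prop :=
  ∀ z, ∀ ε : ℝ, 0 < ε → ∀ᶠ q in l ×ˢ 𝓝 z, G q.1 q.2 ⊆ Metric.cthickening ε (H z)

variable {a : ℕ → ℝ} {x y m : ℕ → State d} {ι : Type*} {n : ι → ℕ} {c : ι → ℝ}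

theorem IsRescaledWindow.isSolution_of_tendstoUniformlyOn {l : Filter ι} [l.NeBot]
    (hw : IsRescaledWindow a x l n c) (hp : IsPerturbedEuler a x y m)
    (hy : ∀ n, y n ∈ h (x n)) (hclosed : ∀ z, IsClosed (H z)) (hconv : ∀ z, Convex ℝ (H z))
    (hupper : TendstoUpper (fun i => rescale h (c i)) l H) {φ : ℝ → State d}
    (hlip : ∀ T : ℝ, ∃ L : NNReal, LipschitzOnWith L φ (Set.Icc 0 T))
    (hφ : ∀ T : ℝ, TendstoUniformlyOn (fun i => rescaledPath a x (n i) (c i)) φ l (Set.Icc 0 T)) :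
    IsSolution H φ := by
  refine isSolution_of_right_quotients hclosed hlip fun t ht ε hε => ?_
  have hlim : ∀ s, 0 ≤ s → Tendsto (fun i => rescaledPath a x (n i) (c i) s) l (𝓝 (φ s)) :=
    fun s hs => (hφ s).tendsto_at ⟨hs, le_rfl⟩
  obtain ⟨P, hP, R, hR, hPR⟩ := eventually_prod_iff.1 (hupper (φ t) ε hε)
  obtain ⟨δ, hδ, hball⟩ := Metric.eventually_nhds_iff_ball.1 hR
  have hcont : ∀ᶠ r in 𝓝 t, dist (φ r) (φ t) < δ / 2 := by
    obtain ⟨L, hL⟩ := hlip (t + 1)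
    exact Metric.tendsto_nhds.1 (hL.continuousOn.continuousAt
      (Icc_mem_nhds ht (lt_add_one t))) _ (half_pos hδ)
  obtain ⟨b, htb, hb⟩ := mem_nhdsGE_iff_exists_Ico_subset.1 (mem_nhdsWithin_of_mem_nhds hcont)
  filter_upwards [Ioo_mem_nhdsGT htb] with s hs
  refine hw.inv_smul_sub_mem hp Metric.isClosed_cthickening ((hconv _).cthickening ε) ht.le hs.1
    (hlim t ht.le) (hlim s (ht.trans hs.1).le) ?_
  filter_upwards [hP, Metric.tendstoUniformlyOn_iff.1 (hφ s) (δ / 2) (half_pos hδ),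
    hw.one_le_scale] with i hi hclose hci j hj
  have hxj : (c i)⁻¹ • x j ∈ Metric.ball (φ t) δ := by
    have hφj := hclose _ ⟨ht.le.trans hj.1, hj.2.le⟩
    rw [rescaledPath_clock_sub hp.stepSizes, dist_comm] at hφj
    have hφt := hb ⟨hj.1, hj.2.trans hs.2⟩
    rw [Set.mem_ofPred_eq] at hφt
    exact Metric.mem_ball.2
      ((dist_triangle _ _ _).trans_lt ((add_lt_add hφj hφt).trans_eq (add_halves δ)))
  refine hPR hi (hball _ hxj) ?_
  have hci0 : c i ≠ 0 := (one_pos.trans_le hci).ne'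
  simpa only [rescale, Set.mem_ofPred_eq, smul_inv_smul₀ hci0] using hy j

theorem IsRescaledWindow.exists_isSolution_tendstoUniformlyOn {U : Ultrafilter ι}
    (hw : IsRescaledWindow a x U n c) (hp : IsPerturbedEuler a x y m)
    (hy : ∀ n, y n ∈ h (x n)) (hclosed : ∀ z, IsClosed (H z)) (hconv : ∀ z, Convex ℝ (H z))
    (hupper : TendstoUpper (fun i => rescale h (c i)) (U : Filter ι) H) :
    ∃ φ : ℝ → State d, IsSolution H φ ∧
      ∀ T : ℝ, TendstoUniformlyOn (fun i => rescaledPath a x (n i) (c i)) φ U (Set.Icc 0 T) := by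
  obtain ⟨φ, hlip, hφ⟩ := hw.exists_tendstoUniformlyOn hp
  exact ⟨φ, hw.isSolution_of_tendstoUniformlyOn hp hy hclosed hconv hupper hlip hφ, hφ⟩

end LimitingInclusion

section Semicontinuity

lemma eventually_subset_cthickening_of_seq {α E : Type*} [PseudoMetricSpace E] {l : Filter α}
    [l.IsCountablyGenerated] {G : α → Set E} {K S : Set E} (hK : IsCompact K)
    (hGK : ∀ᶠ p in l, G p ⊆ K)
    (hS : ∀ (p : ℕ → α) (v : ℕ → E) (w : E), Tendsto p atTop l → Tendsto v atTop (𝓝 w) →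
      (∀ n, v n ∈ G (p n)) → w ∈ S) {ε : ℝ} (hε : 0 < ε) :
    ∀ᶠ p in l, G p ⊆ Metric.cthickening ε S := by
  by_contra hcon
  obtain ⟨p, hp, hpG⟩ :=
    exists_seq_forall_of_frequently ((not_eventually.1 hcon).and_eventually hGK)
  choose v hv hvS using fun n => Set.not_subset.1 (hpG n).1
  obtain ⟨w, -, ψ, hψ, hw⟩ := hK.tendsto_subseq fun n => (hpG n).2 (hv n)
  have hwS : w ∈ S := hS (p ∘ ψ) (v ∘ ψ) w (hp.comp hψ.tendsto_atTop) hw fun n => hv (ψ n)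
  obtain ⟨n, hn⟩ := (hw.eventually (Metric.closedBall_mem_nhds w hε)).exists
  exact hvS _ (Metric.mem_cthickening_of_dist_le _ w _ _ hwS hn)

variable {d : ℕ} {h H : State d → Set (State d)}

lemma exists_isCompact_eventually_rescale_subset
    (hg : ∃ K : ℝ, 0 < K ∧ ∀ z, ∀ w ∈ h z, ‖w‖ < K * (1 + ‖z‖)) {α : Type*} {l : Filter α}
    {c : α → ℝ} {u : α → State d} {z : State d} (hc : ∀ᶠ p in l, 1 ≤ c p)
    (hu : Tendsto u l (𝓝 z)) :
    ∃ Q : Set (State d), IsCompact Q ∧ ∀ᶠ p in l, rescale h (c p) (u p) ⊆ Q := by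
  obtain ⟨K, hK, hg⟩ := hg
  refine ⟨_, isCompact_closedBall 0 (K * (1 + (‖z‖ + 1))), ?_⟩
  filter_upwards [hc, hu.norm.eventually_le_const (lt_add_one ‖z‖)] with p hcp hup w hw
  have hcp0 : 0 < c p := one_pos.trans_le hcp
  rw [mem_closedBall_zero_iff]
  refine le_of_mul_le_mul_left ?_ hcp0
  calc c p * ‖w‖ = ‖c p • w‖ := by rw [norm_smul, Real.norm_of_nonneg hcp0.le]
    _ ≤ K * (1 + ‖c p • u p‖) := (hg _ _ hw).le
    _ = K * (1 + c p * ‖u p‖) := by rw [norm_smul, Real.norm_of_nonneg hcp0.le]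
    _ ≤ K * (c p + c p * (‖z‖ + 1)) := by gcongr
    _ = c p * (K * (1 + (‖z‖ + 1))) := by ring

lemma rescale_one (z : State d) : rescale h 1 z = h z := by
  ext w
  simp only [rescale, one_smul, Set.mem_ofPred_eq]

theorem IsMarchaud.tendstoUpper (A1 : IsMarchaud h) {ι : Type*} (l : Filter ι) :
    TendstoUpper (fun _ => rescale h 1) l h := by
  refine fun z ε hε => tendsto_snd.eventually (p := fun u => rescale h 1 u ⊆ _) ?_
  obtain ⟨Q, hQ, hsub⟩ := exists_isCompact_eventually_rescale_subset A1.growth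
    (c := fun _ => 1) (Eventually.of_forall fun _ => le_rfl) (tendsto_id (x := 𝓝 z))
  refine eventually_subset_cthickening_of_seq hQ hsub (fun u v w hu hv hvu => ?_) hε
  exact A1.closed_graph.mem_of_tendsto (hu.prodMk_nhds hv)
    (Eventually.of_forall fun n => (rescale_one (u n)).subset (hvu n))

/-- Limits of `y_n ∈ h_{c_n}(x_n)` along integers `c_n ↑ ∞` lie in `H`. The condition
`InfinityClosed h` is the case `H = h_∞`. -/
def IsBlowUpClosed (h H : State d → Set (State d)) : Prop :=
  ∀ (c : ℕ → ℕ) (u v : ℕ → State d) (x y : State d),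
    StrictMono c → (∀ n, 1 ≤ c n) → Tendsto u atTop (𝓝 x) → Tendsto v atTop (𝓝 y) →
    (∀ n, v n ∈ rescale h (c n : ℝ) (u n)) → y ∈ H x

theorem IsBlowUpClosed.tendstoUpper (hH : IsBlowUpClosed h H)
    (hg : ∃ K : ℝ, 0 < K ∧ ∀ z, ∀ w ∈ h z, ‖w‖ < K * (1 + ‖z‖)) :
    TendstoUpper (fun c : ℕ => rescale h (c : ℝ)) atTop H := by
  intro z ε hε
  obtain ⟨Q, hQ, hsub⟩ := exists_isCompact_eventually_rescale_subset hg (l := atTop ×ˢ 𝓝 z)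
    (c := fun q : ℕ × State d => (q.1 : ℝ))
    (tendsto_fst.eventually ((eventually_ge_atTop 1).mono fun _ => Nat.one_le_cast.2)) tendsto_snd
  refine eventually_subset_cthickening_of_seq hQ hsub (fun p v w hp hv hvp => ?_) hε
  obtain ⟨hc, hu⟩ := tendsto_prod_iff'.1 hp
  obtain ⟨θ, hθ, hcθ⟩ := strictMono_subseq_of_tendsto_atTop hc
  -- A strictly increasing sequence of naturals is positive from its second term on.
  have hshift : StrictMono fun n => θ (n + 1) := hθ.comp fun _ _ => Nat.succ_lt_succ
  exact hH (fun n => (p (θ (n + 1))).1) (fun n => (p (θ (n + 1))).2) (fun n => v (θ (n + 1))) z w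
    (hcθ.comp fun _ _ => Nat.succ_lt_succ)
    (fun n => (Nat.le_add_left 1 n).trans (hcθ.le_apply (x := n + 1)))
    (hu.comp hshift.tendsto_atTop) (hv.comp hshift.tendsto_atTop) fun n => hvp _

lemma TendstoUpper.comp {ι κ : Type*} {G : ι → State d → Set (State d)} {l : Filter ι}
    (hG : TendstoUpper G l H) {f : κ → ι} {l' : Filter κ} (hf : Tendsto f l' l) :
    TendstoUpper (fun k => G (f k)) l' H :=
  fun z ε hε => (hf.prodMap tendsto_id).eventually (hG z ε hε)

lemma mem_lowerLimit_iff {S : ℝ → Set (State d)} {p : State d} :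
    p ∈ lowerLimit S ↔ ∀ ε : ℝ, 0 < ε → ∀ᶠ c in atTop, p ∈ Metric.thickening ε (S c) := by
  rw [lowerLimit, Set.mem_ofPred_eq, ENNReal.nhds_zero_basis.tendsto_right_iff]
  refine ⟨fun hp ε hε => hp _ (ENNReal.ofReal_pos.2 hε), fun hp ε hε => ?_⟩
  obtain ⟨δ, -, hδ, hδε⟩ := ENNReal.lt_iff_exists_real_btwn.1 hε
  filter_upwards [hp δ (ENNReal.ofReal_pos.1 hδ)] with c hc using lt_trans hc hδε

lemma convex_lowerLimit {S : ℝ → Set (State d)} (hS : ∀ c, Convex ℝ (S c)) :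
    Convex ℝ (lowerLimit S) := by
  intro p hp q hq α β hα hβ hαβ
  rw [mem_lowerLimit_iff] at hp hq ⊢
  intro ε hε
  filter_upwards [hp ε hε, hq ε hε] with c hpc hqc
  exact (hS c).thickening ε hpc hqc hα hβ hαβ

lemma convex_hInf (hconv : ∀ z, Convex ℝ (h z)) (z : State d) : Convex ℝ (hInf h z) :=
  (convex_lowerLimit fun c =>
    (hconv (c • z)).affine_preimage (LinearMap.lsmul ℝ (State d) c).toAffineMap).closure

end Semicontinuity

section Boundedness

theorem IsPerturbedEuler.exists_norm_le_of_eventually_jump {E : Type*} [SeminormedAddCommGroup E]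
    [NormedSpace ℝ E] {a : ℕ → ℝ} {x y m : ℕ → E} (hp : IsPerturbedEuler a x y m) {T R : ℝ}
    (hT : 0 < T) (hjump : ∀ᶠ n in atTop,
      R ≤ ‖x n‖ → ‖x (clockIndex a (clock a n + T))‖ ≤ ‖x n‖) :
    ∃ B : ℝ, ∀ n, ‖x n‖ ≤ B := by
  obtain ⟨C, hC1, hC⟩ := hp.exists_norm_le_mul_max (T + 1)
  obtain ⟨n₀, hn₀⟩ := eventually_atTop.1
    (hC.and ((hp.stepSizes.eventually_clock_clockIndex_lt one_pos).and hjump))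
  set B : ℝ := max ‖x n₀‖ (C * max 1 R)
  have hstay : ∀ n, n₀ ≤ n → ‖x n‖ ≤ B → ‖x (clockIndex a (clock a n + T))‖ ≤ B := by
    intro n hn hnB
    obtain ⟨hwindow, hclock, hfar⟩ := hn₀ n hn
    rcases le_total R ‖x n‖ with hle | hle
    · exact (hfar hle).trans hnB
    · calc ‖x (clockIndex a (clock a n + T))‖ ≤ C * max 1 ‖x n‖ :=
            hwindow _ (hp.stepSizes.le_clockIndex_add n hT.le) (by linarith [hclock T hT.le])
        _ ≤ C * max 1 R := by gcongr
        _ ≤ B := le_max_right _ _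
  have hbdd : IsBoundedUnder (· ≤ ·) atTop fun k => ‖x k‖ := by
    refine isBoundedUnder_of_eventually_le (a := C * max 1 B) ?_
    filter_upwards [eventually_ge_atTop n₀] with k hk
    obtain ⟨n, hn, hnk, hnB, hkn⟩ := hp.stepSizes.exists_jump_start hT
      (P := fun n => ‖x n‖ ≤ B) (le_max_left _ _) hstay hk
    exact ((hn₀ n hn).1 k hnk (by linarith)).trans (by gcongr)
  obtain ⟨B', hB'⟩ := hbdd.bddAbove_range
  exact ⟨B', fun n => hB' (Set.mem_range_self n)⟩

variable {d : ℕ} {h H : State d → Set (State d)} {A U : Set (State d)}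

lemma IsAttractingSet.exists_norm_lt_one (hA : IsAttractingSet H A U)
    (hU : Metric.closedBall 0 1 ⊆ U) (hA1 : A ⊆ Metric.ball 0 1) :
    ∃ T : ℝ, 0 < T ∧ ∀ φ, IsSolution H φ → ‖φ 0‖ ≤ 1 → ‖φ T‖ < 1 := by
  obtain ⟨δ, hδ, hδA⟩ := hA.compact.exists_thickening_subset_open Metric.isOpen_ball hA1
  obtain ⟨T, -, hT⟩ := hA.attracts δ hδ
  refine ⟨max T 1, one_pos.trans_le (le_max_right _ _), fun φ hφ hφ0 => ?_⟩
  have hmem : φ (max T 1) ∈ flowImage H (Set.Ici T) U :=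
    Set.mem_iUnion₂.2 ⟨max T 1, Set.mem_Ici.2 (le_max_left _ _),
      Set.mem_iUnion₂.2 ⟨φ 0, hU (mem_closedBall_zero_iff.2 hφ0), φ, hφ, rfl, rfl⟩⟩
  exact mem_ball_zero_iff.1 (hδA (hT hmem))

namespace IsPerturbedEuler

variable {a : ℕ → ℝ} {x y m : ℕ → State d}

/- The scales `c n = ⌈‖x n‖⌉` are integers, as `IsBlowUpClosed` requires. -/
theorem exists_blowUp_solution (hp : IsPerturbedEuler a x y m) (hy : ∀ n, y n ∈ h (x n))
    (hg : ∃ K : ℝ, 0 < K ∧ ∀ z, ∀ w ∈ h z, ‖w‖ < K * (1 + ‖z‖))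
    (hclosed : ∀ z, IsClosed (H z)) (hconv : ∀ z, Convex ℝ (H z)) (hH : IsBlowUpClosed h H)
    {F : Ultrafilter ℕ} (hF : (F : Filter ℕ) ≤ atTop) (hx : Tendsto (fun n => ‖x n‖) F atTop) :
    ∃ φ : ℝ → State d, IsSolution H φ ∧ ‖φ 0‖ = 1 ∧ ∀ s, 0 ≤ s →
      Tendsto (fun n => rescaledPath a x n ⌈‖x n‖⌉₊ s) F (𝓝 (φ s)) := by
  have hw : IsRescaledWindow a x F (fun n => n) fun n => (⌈‖x n‖⌉₊ : ℝ) :=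
    .of_norm_start_le hp hF
      ((hx.eventually_gt_atTop 0).mono fun _ hn => Nat.one_le_cast.2 (Nat.ceil_pos.2 hn))
      (Eventually.of_forall fun _ => Nat.le_ceil _)
  obtain ⟨φ, hφ, hlim⟩ := hw.exists_isSolution_tendstoUniformlyOn hp hy hclosed hconv
    ((hH.tendstoUpper hg).comp (tendsto_nat_ceil_atTop.comp hx))
  refine ⟨φ, hφ, ?_, fun s hs => (hlim s).tendsto_at ⟨hs, le_rfl⟩⟩
  have hone : Tendsto (fun n => ‖rescaledPath a x n ⌈‖x n‖⌉₊ 0‖) F (𝓝 1) := by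
    simpa [rescaledPath_zero hp.stepSizes, norm_smul, Function.comp_def, div_eq_inv_mul] using
      ((tendsto_nat_ceil_div_atTop (R := ℝ)).comp hx).inv₀ one_ne_zero
  exact tendsto_nhds_unique ((hlim 0).tendsto_at ⟨le_rfl, le_rfl⟩).norm hone

theorem exists_norm_le (hp : IsPerturbedEuler a x y m) (hy : ∀ n, y n ∈ h (x n))
    (hg : ∃ K : ℝ, 0 < K ∧ ∀ z, ∀ w ∈ h z, ‖w‖ < K * (1 + ‖z‖))
    (hclosed : ∀ z, IsClosed (H z)) (hconv : ∀ z, Convex ℝ (H z)) (hH : IsBlowUpClosed h H)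
    (hA : IsAttractingSet H A U) (hU : Metric.closedBall 0 1 ⊆ U) (hA1 : A ⊆ Metric.ball 0 1) :
    ∃ B : ℝ, ∀ n, ‖x n‖ ≤ B := by
  obtain ⟨T, hT, hφT⟩ := hA.exists_norm_lt_one hU hA1
  have hfar : ∀ᶠ n in atTop ⊓ comap (fun n => ‖x n‖) atTop,
      ‖x (clockIndex a (clock a n + T))‖ ≤ ‖x n‖ := by
    refine mem_iff_ultrafilter.2 fun F hF => ?_
    obtain ⟨φ, hφ, hφ0, hlim⟩ := hp.exists_blowUp_solution hy hg hclosed hconv hH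
      (hF.trans inf_le_left) (tendsto_iff_comap.2 (hF.trans inf_le_right))
    by_contra hout
    have hφ0T : ‖φ 0‖ ≤ ‖φ T‖ := by
      refine le_of_tendsto_of_tendsto (hlim 0 le_rfl).norm (hlim T hT.le).norm ?_
      filter_upwards [Ultrafilter.eventually_not.2 hout] with n hn
      rw [rescaledPath_zero hp.stepSizes, rescaledPath, norm_smul, norm_smul]
      exact mul_le_mul_of_nonneg_left (not_le.1 hn).le (norm_nonneg _)
    exact (hφT φ hφ hφ0.le).not_ge (hφ0.symm.trans_le hφ0T)
  obtain ⟨⟨N, R⟩, -, hNR⟩ := ((atTop_basis.inf (atTop_basis.comap _)).eventually_iff).1 hfar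
  refine hp.exists_norm_le_of_eventually_jump hT (R := R) ?_
  filter_upwards [eventually_ge_atTop N] with n hn hR using hNR ⟨hn, hR⟩

end IsPerturbedEuler

end Boundedness

section Chains

variable {d : ℕ} {H : State d → Set (State d)}

lemma IsSolution.continuousOn {φ : ℝ → State d} (hφ : IsSolution H φ) {T : ℝ} (hT : 0 ≤ T) :
    ContinuousOn φ (Set.Icc 0 T) := by
  simpa only [Set.uIcc_of_le hT] using (hφ.absCont T hT).continuousOn

namespace HasChain

variable {S : Set (State d)} {ε T t : ℝ} {p q : State d} {φ : ℝ → State d}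

lemma single (hφ : IsSolution H φ) (ht : T < t) (hS : ∀ s ∈ Set.Icc 0 t, φ s ∈ S)
    (hp : φ 0 ∈ S) (hq : q ∈ S) (hd : dist (φ t) q < ε) : HasChain H S ε T (φ 0) q := by
  refine ⟨0, ![φ 0, q], fun _ => φ, fun _ => t, rfl, rfl, ?_, ?_⟩
  · exact Fin.forall_fin_two.2 ⟨hp, hq⟩
  · exact Fin.forall_fin_one.2 ⟨hφ, rfl, ht, hS, hd⟩

lemma cons (hφ : IsSolution H φ) (ht : T < t) (hS : ∀ s ∈ Set.Icc 0 t, φ s ∈ S)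
    (hφ0 : φ 0 ∈ S) (hd : dist (φ t) p < ε) (hc : HasChain H S ε T p q) :
    HasChain H S ε T (φ 0) q := by
  obtain ⟨n, r, ψ, τ, rfl, rfl, hr, hψ⟩ := hc
  exact ⟨n + 1, Fin.cons (φ 0) r, Fin.cons φ ψ, Fin.cons t τ, rfl, rfl, Fin.cases hφ0 hr,
    Fin.cases ⟨hφ, rfl, ht, hS, hd⟩ hψ⟩

lemma mem_of_disjoint_thickening {P Q : Set (State d)}
    (hPQ : Disjoint (Metric.thickening ε P) (Metric.thickening ε Q)) (hε : 0 < ε) (hT : 0 ≤ T)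
    (hc : HasChain H (P ∪ Q) ε T p q) (hp : p ∈ P) : q ∈ P := by
  have hsplit : ∀ z ∈ P ∪ Q, z ∈ Metric.thickening ε P → z ∈ P := fun z hz hzP =>
    hz.resolve_right fun hzQ =>
      Set.disjoint_left.1 hPQ hzP (Metric.self_subset_thickening hε Q hzQ)
  obtain ⟨n, r, ψ, τ, rfl, rfl, hr, hψ⟩ := hc
  refine Fin.induction hp (fun i hi => ?_) (Fin.last (n + 1))
  obtain ⟨hsol, hstart, hτ, hmem, hjump⟩ := hψ i
  have hτ0 : 0 ≤ τ i := hT.trans hτ.le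
  have hpath : ψ i '' Set.Icc 0 (τ i) ⊆ Metric.thickening ε P :=
    (isPreconnected_Icc.image _ (hsol.continuousOn hτ0)).subset_left_of_subset_union
      Metric.isOpen_thickening Metric.isOpen_thickening hPQ
      ((Set.image_subset_iff.2 hmem).trans (Set.union_subset_union
        (Metric.self_subset_thickening hε P) (Metric.self_subset_thickening hε Q)))
      ⟨ψ i 0, Set.mem_image_of_mem _ ⟨le_rfl, hτ0⟩,
        hstart ▸ Metric.self_subset_thickening hε P hi⟩
  have hend : ψ i (τ i) ∈ P :=
    hsplit _ (hmem _ ⟨hτ0, le_rfl⟩) (hpath (Set.mem_image_of_mem _ ⟨hτ0, le_rfl⟩))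
  exact hsplit _ (hr _) (Metric.mem_thickening_iff.2 ⟨_, hend, dist_comm (ψ i (τ i)) _ ▸ hjump⟩)

end HasChain

theorem IsInternallyChainTransitive.isPreconnected {S : Set (State d)}
    (hS : IsInternallyChainTransitive H S) : IsPreconnected S := by
  rw [isPreconnected_closed_iff]
  rintro A B hA hB hAB ⟨p, hpS, hpA⟩ ⟨q, hqS, hqB⟩
  by_contra hempty
  have hdisj : Disjoint (S ∩ A) (S ∩ B) :=
    Set.disjoint_left.2 fun z hzA hzB => hempty ⟨z, hzA.1, hzA.2, hzB.2⟩
  obtain ⟨δ, hδ, hthick⟩ := hdisj.exists_thickenings (hS.1.inter_right hA) (hS.1.isClosed.inter hB)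
  have hc := hS.2 p hpS q hqS δ hδ 1 one_pos
  rw [← Set.inter_eq_left.2 hAB, Set.inter_union_distrib_left] at hc
  have hqA := hc.mem_of_disjoint_thickening hthick hδ zero_le_one ⟨hpS, hpA⟩
  exact hempty ⟨q, hqS, hqA.2, hqB⟩

end Chains

section LimitSets

/-- The set of limit points of a sequence, the discrete-time counterpart of an `ω`-limit set. -/
def limitSet {E : Type*} [TopologicalSpace E] (x : ℕ → E) : Set E :=
  {p | MapClusterPt p atTop x}

variable {d : ℕ} {h H : State d → Set (State d)} {S : Set (State d)} {a : ℕ → ℝ}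
  {x y m : ℕ → State d}

/-- `φ` is a solution of `ẋ ∈ H(x)` that stays in `S` and follows the path within `ε` from the
`n`-th iterate on, for time `T`. -/
structure Shadows (H : State d → Set (State d)) (S : Set (State d)) (a : ℕ → ℝ)
    (x : ℕ → State d) (n : ℕ) (T ε : ℝ) (φ : ℝ → State d) : Prop where
  isSolution : IsSolution H φ
  mem : ∀ s, 0 ≤ s → φ s ∈ S
  dist_lt : ∀ k, clock a k - clock a n ∈ Set.Icc 0 T → dist (x k) (φ (clock a k - clock a n)) < ε

namespace Shadows

variable {n k : ℕ} {T τ ε : ℝ} {φ : ℝ → State d} {p q : State d}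

lemma dist_start_lt (hφ : Shadows H S a x n T ε φ) (hT : 0 ≤ T) : dist (x n) (φ 0) < ε := by
  simpa only [sub_self] using hφ.dist_lt n (by rwa [sub_self, Set.left_mem_Icc])

lemma dist_clock_sub_lt (hφ : Shadows H S a x n T (ε / 2) φ)
    (hk : clock a k - clock a n ∈ Set.Icc 0 T) (hp : dist (x k) p < ε / 2) :
    dist (φ (clock a k - clock a n)) p < ε := by
  linarith [dist_triangle_left (φ (clock a k - clock a n)) p (x k), hφ.dist_lt k hk]

lemma hasChain_single (hφ : Shadows H S a x n T (ε / 2) φ) (hτ : 0 ≤ τ)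
    (hk : clock a k - clock a n ∈ Set.Ioc τ T) (hq : dist (x k) q < ε / 2) (hqS : q ∈ S) :
    HasChain H S ε τ (φ 0) q :=
  .single hφ.isSolution hk.1 (fun s hs => hφ.mem s hs.1) (hφ.mem 0 le_rfl) hqS
    (hφ.dist_clock_sub_lt ⟨hτ.trans hk.1.le, hk.2⟩ hq)

lemma hasChain_cons (hφ : Shadows H S a x n T (ε / 2) φ) (hτ : 0 ≤ τ)
    (hk : clock a k - clock a n ∈ Set.Ioc τ T) (hp : dist (x k) p < ε / 2)
    (hc : HasChain H S ε τ p q) : HasChain H S ε τ (φ 0) q :=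
  .cons hφ.isSolution hk.1 (fun s hs => hφ.mem s hs.1) (hφ.mem 0 le_rfl)
    (hφ.dist_clock_sub_lt ⟨hτ.trans hk.1.le, hk.2⟩ hp) hc

/- The path is cut into pieces of clock length between `T` and `2 * T + 2`, and each piece is
replaced by a solution that shadows it. -/
theorem hasChain {N : ℕ} (ha : StepSizes a) (hT : 0 ≤ T)
    (hovershoot : ∀ n, N ≤ n → ∀ s, 0 ≤ s →
      clock a (clockIndex a (clock a n + s)) < clock a n + s + 1)
    (hshadow : ∀ n, N ≤ n → ∃ φ, Shadows H S a x n (2 * T + 2) (ε / 2) φ)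
    (hk : dist (x k) q < ε / 2) (hqS : q ∈ S) (hn : N ≤ n) (hnk : clock a n + T < clock a k)
    (hφ : Shadows H S a x n (2 * T + 2) (ε / 2) φ) : HasChain H S ε T (φ 0) q := by
  induction hj : k - n using Nat.strong_induction_on generalizing n φ with
  | _ j ih =>
    rcases le_or_gt (clock a k - clock a n) (2 * T + 2) with hshort | hlong
    · exact hφ.hasChain_single hT ⟨by linarith, hshort⟩ hk hqS
    · set n' := clockIndex a (clock a n + (T + 1))
      have hlower : clock a n + (T + 1) ≤ clock a n' := ha.le_clock_clockIndex _
      have hupper : clock a n' < clock a n + (T + 1) + 1 := hovershoot n hn _ (by linarith)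
      have hnn' : n < n' := ha.clock_strictMono.lt_iff_lt.1 (by linarith)
      have hn'k : n' < k := ha.clock_strictMono.lt_iff_lt.1 (by linarith)
      obtain ⟨ψ, hψ⟩ := hshadow n' (hn.trans hnn'.le)
      exact hφ.hasChain_cons hT ⟨by linarith, by linarith⟩ (hψ.dist_start_lt (by linarith))
        (ih (k - n') (by omega) (hn.trans hnn'.le) (by linarith) hψ rfl)

end Shadows

namespace IsPerturbedEuler

variable {B : ℝ}

theorem exists_limit_shadow (hp : IsPerturbedEuler a x y m) (hy : ∀ n, y n ∈ h (x n))
    (A1 : IsMarchaud h) (hB : ∀ n, ‖x n‖ ≤ B) {F : Ultrafilter ℕ} (hF : (F : Filter ℕ) ≤ atTop) :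
    ∃ φ : ℝ → State d, Tendsto x F (𝓝 (φ 0)) ∧
      ∀ T ε : ℝ, 0 < ε → ∀ᶠ n in F, Shadows h (limitSet x) a x n T ε φ := by
  have ha := hp.stepSizes
  have hw : IsRescaledWindow a x F (fun n => n) fun _ => 1 :=
    ⟨hF, Eventually.of_forall fun _ => le_rfl, fun T => ⟨max 1 B, le_max_left _ _,
      Eventually.of_forall fun _ k _ _ => by
        rw [mul_one]; exact (hB k).trans (le_max_right _ _)⟩⟩
  obtain ⟨φ, hφ, hlim⟩ := hw.exists_isSolution_tendstoUniformlyOn hp hy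
    (fun z => (A1.compact z).isClosed) A1.convex (A1.tendstoUpper _)
  have hpoint : ∀ s, 0 ≤ s → Tendsto (fun n => x (clockIndex a (clock a n + s))) F (𝓝 (φ s)) := by
    intro s hs
    simpa only [rescaledPath, inv_one, one_smul] using (hlim s).tendsto_at ⟨hs, le_rfl⟩
  refine ⟨φ, by simpa only [add_zero, ha.clockIndex_clock] using hpoint 0 le_rfl,
    fun T ε hε => ?_⟩
  filter_upwards [Metric.tendstoUniformlyOn_iff.1 (hlim T) ε hε] with n hn
  refine ⟨hφ, fun s hs => ?_, fun k hk => ?_⟩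
  · exact MapClusterPt.of_comp (tendsto_atTop_mono (fun n => ha.le_clockIndex_add n hs) hF)
      (hpoint s hs).mapClusterPt
  · simpa only [rescaledPath_clock_sub ha, inv_one, one_smul, dist_comm] using hn _ hk

lemma exists_shadow_of_mem_limitSet (hp : IsPerturbedEuler a x y m) (hy : ∀ n, y n ∈ h (x n))
    (A1 : IsMarchaud h) (hB : ∀ n, ‖x n‖ ≤ B) {p : State d} (hpS : p ∈ limitSet x) :
    ∃ φ : ℝ → State d, φ 0 = p ∧
      ∀ T ε : ℝ, 0 < ε → ∃ᶠ n in atTop, Shadows h (limitSet x) a x n T ε φ := by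
  obtain ⟨F, hF, hFp⟩ := mapClusterPt_iff_ultrafilter.1 hpS
  obtain ⟨φ, hφ0, hφ⟩ := hp.exists_limit_shadow hy A1 hB hF
  exact ⟨φ, tendsto_nhds_unique hφ0 hFp, fun T ε hε => (hφ T ε hε).frequently.filter_mono hF⟩

lemma eventually_exists_shadow (hp : IsPerturbedEuler a x y m) (hy : ∀ n, y n ∈ h (x n))
    (A1 : IsMarchaud h) (hB : ∀ n, ‖x n‖ ≤ B) (T : ℝ) {ε : ℝ} (hε : 0 < ε) :
    ∀ᶠ n in atTop, ∃ φ, Shadows h (limitSet x) a x n T ε φ := by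
  refine mem_iff_ultrafilter.2 fun F hF => ?_
  obtain ⟨φ, -, hφ⟩ := hp.exists_limit_shadow hy A1 hB hF
  filter_upwards [hφ T ε hε] with n hn using ⟨φ, hn⟩

theorem isInvariant_limitSet (hp : IsPerturbedEuler a x y m) (hy : ∀ n, y n ∈ h (x n))
    (A1 : IsMarchaud h) (hB : ∀ n, ‖x n‖ ≤ B) : IsInvariant h (limitSet x) := by
  intro p hpS
  obtain ⟨φ, hφ0, hφ⟩ := hp.exists_shadow_of_mem_limitSet hy A1 hB hpS
  obtain ⟨_, hn⟩ := (hφ 0 1 one_pos).exists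
  exact ⟨φ, hn.isSolution, hφ0, hn.mem⟩

theorem tendsto_infDist_limitSet (hp : IsPerturbedEuler a x y m) (hy : ∀ n, y n ∈ h (x n))
    (A1 : IsMarchaud h) (hB : ∀ n, ‖x n‖ ≤ B) :
    Tendsto (fun n => Metric.infDist (x n) (limitSet x)) atTop (𝓝 0) := by
  rw [Metric.tendsto_nhds]
  intro ε hε
  filter_upwards [hp.eventually_exists_shadow hy A1 hB 0 hε] with n ⟨φ, hφ⟩
  rw [Real.dist_0_eq_abs, abs_of_nonneg Metric.infDist_nonneg]
  exact (Metric.infDist_le_dist_of_mem (hφ.mem 0 le_rfl)).trans_lt (hφ.dist_start_lt le_rfl)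

theorem hasChain_limitSet (hp : IsPerturbedEuler a x y m) (hy : ∀ n, y n ∈ h (x n))
    (A1 : IsMarchaud h) (hB : ∀ n, ‖x n‖ ≤ B) {p q : State d} (hpS : p ∈ limitSet x)
    (hqS : q ∈ limitSet x) {ε T : ℝ} (hε : 0 < ε) (hT : 0 ≤ T) :
    HasChain h (limitSet x) ε T p q := by
  obtain ⟨N, hN⟩ := eventually_atTop.1
    ((hp.stepSizes.eventually_clock_clockIndex_lt one_pos).and
      (hp.eventually_exists_shadow hy A1 hB (2 * T + 2) (half_pos hε)))
  obtain ⟨φ, rfl, hφ⟩ := hp.exists_shadow_of_mem_limitSet hy A1 hB hpS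
  obtain ⟨n, hnφ, hn⟩ := ((hφ (2 * T + 2) _ (half_pos hε)).and_eventually
    (eventually_ge_atTop N)).exists
  have hnear : ∃ᶠ k in atTop, dist (x k) q < ε / 2 :=
    mapClusterPt_iff_frequently.1 hqS _ (Metric.ball_mem_nhds q (half_pos hε))
  obtain ⟨k, hkq, hnk⟩ := (hnear.and_eventually
    (hp.stepSizes.sum_diverges.eventually_gt_atTop (clock a n + T))).exists
  exact hnφ.hasChain hp.stepSizes hT (fun n hn => (hN n hn).1) (fun n hn => (hN n hn).2) hkq hqS
    hn hnk

end IsPerturbedEuler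

section ProperSpace

variable {E : Type*} [SeminormedAddCommGroup E] [ProperSpace E] {x : ℕ → E} {B : ℝ}

lemma isCompact_limitSet (hB : ∀ n, ‖x n‖ ≤ B) : IsCompact (limitSet x) := by
  refine (isCompact_closedBall 0 B).of_isClosed_subset isClosed_setOfPred_clusterPt fun p hp => ?_
  exact Metric.isClosed_closedBall.mem_of_mapClusterPt hp
    (Eventually.of_forall fun n => mem_closedBall_zero_iff.2 (hB n))

lemma nonempty_limitSet (hB : ∀ n, ‖x n‖ ≤ B) : (limitSet x).Nonempty := by
  obtain ⟨p, -, hp⟩ := (isCompact_closedBall 0 B).exists_mapClusterPt (f := atTop) (u := x)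
    (tendsto_principal.2 (Eventually.of_forall fun n => mem_closedBall_zero_iff.2 (hB n)))
  exact ⟨p, hp⟩

end ProperSpace

end LimitSets

end SRI

theorem theorem2_general {Ω : Type*} [MeasurableSpace Ω] (μ : Measure Ω) [IsFiniteMeasure μ]
    {d : ℕ} (h H : SRI.State d → Set (SRI.State d)) (a : ℕ → ℝ)
    (x y M : ℕ → Ω → SRI.State d)
    (hrec : ∀ n, ∀ᵐ ω ∂μ, x (n + 1) ω = x n ω + a n • (y n ω + M (n + 1) ω))
    (hy : ∀ n, ∀ᵐ ω ∂μ, y n ω ∈ h (x n ω))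
    (A1 : SRI.IsMarchaud h)
    (A2 : SRI.StepSizes a)
    (A3 : SRI.MartingaleNoise μ x M)
    (hclosed : ∀ z, IsClosed (H z)) (hconv : ∀ z, Convex ℝ (H z))
    {A U : Set (SRI.State d)} (hA : SRI.IsAttractingSet H A U)
    (hU : Metric.closedBall 0 1 ⊆ U) (hA1 : A ⊆ Metric.ball 0 1)
    (hH : SRI.IsBlowUpClosed h H) :
    ∀ᵐ ω ∂μ, Bornology.IsBounded (Set.range fun n => x n ω) ∧
      ∃ S : Set (SRI.State d), IsClosed S ∧ IsConnected S ∧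
        SRI.IsInternallyChainTransitive h S ∧ SRI.IsInvariant h S ∧
        Tendsto (fun n => Metric.infDist (x n ω) S) atTop (𝓝 0) := by
  filter_upwards [ae_all_iff.2 hrec, ae_all_iff.2 hy, A3.ae_noiseNegligible A2.sq_summable]
    with ω hstep hdrift hnoise
  have hgrowth : ∃ K : ℝ, 0 < K ∧ ∀ n, ‖y n ω‖ ≤ K * (1 + ‖x n ω‖) := by
    obtain ⟨K, hK, hg⟩ := A1.growth
    exact ⟨K, hK, fun n => (hg _ _ (hdrift n)).le⟩
  have hp : SRI.IsPerturbedEuler a (x · ω) (y · ω) (M · ω) := ⟨A2, hstep, hgrowth, hnoise⟩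
  obtain ⟨B, hB⟩ := hp.exists_norm_le hdrift A1.growth hclosed hconv hH hA hU hA1
  have hict : SRI.IsInternallyChainTransitive h (SRI.limitSet (x · ω)) :=
    ⟨SRI.isCompact_limitSet hB, fun p hpS q hqS ε hε T hT =>
      hp.hasChain_limitSet hdrift A1 hB hpS hqS hε hT.le⟩
  exact ⟨isBounded_iff_forall_norm_le.2 ⟨B, Set.forall_mem_range.2 hB⟩, SRI.limitSet (x · ω),
    hict.1.isClosed, ⟨SRI.nonempty_limitSet hB, hict.isPreconnected⟩, hict,
    hp.isInvariant_limitSet hdrift A1 hB, hp.tendsto_infDist_limitSet hdrift A1 hB⟩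

theorem theorem2 {Ω : Type*} [MeasurableSpace Ω] (μ : Measure Ω) [IsProbabilityMeasure μ]
    {d : ℕ} (h : SRI.State d → Set (SRI.State d)) (a : ℕ → ℝ)
    (x y M : ℕ → Ω → SRI.State d)
    (hrec : ∀ n, ∀ᵐ ω ∂μ, x (n + 1) ω = x n ω + a n • (y n ω + M (n + 1) ω))
    (hy : ∀ n, ∀ᵐ ω ∂μ, y n ω ∈ h (x n ω))
    (A1 : SRI.IsMarchaud h)
    (A2 : SRI.StepSizes a)
    (A3 : SRI.MartingaleNoise μ x M)
    (A4 : SRI.InfinityAttracting h)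
    (A5 : SRI.InfinityClosed h) :
    ∀ᵐ ω ∂μ, Bornology.IsBounded (Set.range fun n => x n ω) ∧
      ∃ S : Set (SRI.State d), IsClosed S ∧ IsConnected S ∧
        SRI.IsInternallyChainTransitive h S ∧ SRI.IsInvariant h S ∧
        Tendsto (fun n => Metric.infDist (x n ω) S) atTop (𝓝 0) := by
  obtain ⟨A, U, hA, hU, hA1⟩ := A4.attracting
  exact theorem2_general μ h (SRI.hInf h) a x y M hrec hy A1 A2 A3 (fun _ => isClosed_closure)
    (SRI.convex_hInf A1.convex) hA hU hA1 A5
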